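/- Let $(x,y)$ have an unknown law $p(x,y)$ on $\mathcal X\times\{-1,+1\}$, with class priors $\pi_\pm=p(y=\pm1)$, $\pi_+\neq\pi_-$, and class-conditional laws $p_\pm$. Let $\ell:\mathbb R\times\{-1,+1\}\to[0,\infty)$ be a loss and $R(g)=\mathbb E_{p(x,y)}[\ell(g(x),y)]$. Put $$\widetilde p_t=\frac{\pi_t\,p_t+\pi_{-t}^2\,p_{-t}}{\pi_{-t}^2+\pi_t}\quad(t\in\{+,-\}),\qquad p_{\mathrm S}=\frac{\pi_+^2\,p_+\otimes p_++\pi_-^2\,p_-\otimes p_-}{\pi_+^2+\pi_-^2},\qquad p_{\mathrm D}=\tfrac12\,p_+\otimes p_-+\tfrac12\,p_-\otimes p_+ .$$ One observes $n_{\mathrm S}\ge1$ i.i.d. similar pairs $(x^+_{\mathrm S,i},x^-_{\mathrm S,i})$ and $n_{\mathrm D}\ge1$ i.i.d. dissimilar pairs $(x^+_{\mathrm D,i},x^-_{\mathrm D,i})$. The law of a similar pair either has marginals $\widetilde p_+$ and $\widetilde p_-$ (pairwise-comparison sampling, with arbitrary coupling inside a pair) or is $p_{\mathrm S}$; the law of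 a dissimilar pair either has marginals $\widetilde p_+$ and $\widetilde p_-$ or is $p_{\mathrm D}$. The empirical risk is $$\widehat R(g)=\sum_{t\in\{+,-\}}\frac1{n_{\mathrm S}}\sum_{i=1}^{n_{\mathrm S}}\frac{\pi_t^2}{\pi_+-\pi_-}\bigl[\pi_+\ell(g(x^t_{\mathrm S,i}),+1)-\pi_-\ell(g(x^t_{\mathrm S,i}),-1)\bigr]+\sum_{t\in\{+,-\}}\frac1{n_{\mathrm D}}\sum_{i=1}^{n_{\mathrm D}}\frac{\pi_t^2-\pi_{-t}}{\pi_+-\pi_-}\bigl[\pi_-\ell(g(x^t_{\mathrm D,i}),+1)-\pi_+\ell(g(x^t_{\mathrm D,i}),-1)\bigr].$$ Let $\mathcal G$ be a class of measurable functions $g:\mathcal X\to\mathbb R$ with $\sup_{g\in\mathcal G}\|g\|_\infty\le C_g$, containing a countable subclass that is sequentially dense for pointwise convergence (so that suprema over $\mathcal G$ are measurable). Assume $\ell(z,y)\le C_\ell$ for $|z|\le C_g$, that $z\mapsto\ell(z,y)$ is $L_\ell$-Lipschitz for both $y$, and that the Rademacher complexity $\mathfrak R(\mathcal G;n,\mu)=\mathbb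 E_{x_1,\dots,x_n\sim\mu}\mathbb E_\sigma\bigl[\sup_{g\in\mathcal G}\frac1n\sum_{i=1}^n\sigma_ig(x_i)\bigr]$ is at most $C_{\mathcal G}/\sqrt n$ for every $n\ge1$ and every $\mu$ among the marginal laws of the observed pairs. Let $g^*$ minimize $R$ over $\mathcal G$, and let $\hat g$ denote any minimizer of $\widehat R$ over $\mathcal G$. Then for every $\delta>0$ and all $n_{\mathrm S},n_{\mathrm D}\ge1$, with probability at least $1-\delta$, $$R(\hat g)-R(g^*)\le C_{\mathcal G,\ell,\delta}\left\{\frac{\pi_+^2+\pi_-^2}{\sqrt{2n_{\mathrm S}}}+\frac{|\pi_+^2-\pi_-|+|\pi_+-\pi_-^2|}{\sqrt{2n_{\mathrm D}}}\right\},\qquad C_{\mathcal G,\ell,\delta}=\frac{4L_\ell C_{\mathcal G}+2C_\ell\sqrt{\log(4/\delta)}}{|\pi_+-\pi_-|},$$ where the square root is read as $0$ when $\delta>4$. Consequently $R(\hat g)-R(g^*)=\mathcal O_p(1/\sqrt{n_{\mathrm S}}+1/\sqrt{n_{\mathrm D}})$, and $R(\hat g)\to R(g^*)$ in probability as $n_{\mathrm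 S},n_{\mathrm D}\to\infty$. -/

import Mathlib

open MeasureTheory ProbabilityTheory Filter Topology
open scoped NNReal ENNReal

universe w u

noncomputable section

namespace SDPcomp

/-! Labels are Booleans: `true` is the positive label `+1`, `false` is the negative label `-1`,
and `!t` is the opposite label `-t`. The joint law of an instance and its label is a probability
measure `ρ` on `X × Bool`. -/


variable {X : Type u} [MeasurableSpace X]

/-- The class prior `π_t = p(y = t)`. -/
def prior (ρ : Measure (X × Bool)) (t : Bool) : ℝ := ρ.real {p | p.2 = t}

/-- The class-conditional law `p_t(x) = p(x ∣ y = t)`. -/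
def classLaw (ρ : Measure (X × Bool)) (t : Bool) : Measure X :=
  (ProbabilityTheory.cond ρ {p | p.2 = t}).map Prod.fst

/-- The classification risk `R(g) = E_{p(x,y)} [ℓ(g(x), y)]`. -/
def risk (ρ : Measure (X × Bool)) (ℓ : ℝ → Bool → ℝ) (g : X → ℝ) : ℝ :=
  ∫ p, ℓ (g p.1) p.2 ∂ρ

/-- The law of the first (`t = true`) and of the second (`t = false`) instance of a pair with a
pairwise-comparison label:
`(π_t p_t + π_{-t}² p_{-t}) / (π_{-t}² + π_t)`. -/
def pcompLaw (ρ : Measure (X × Bool)) (t : Bool) : Measure X :=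
  ENNReal.ofReal (prior ρ t / (prior ρ (!t) ^ 2 + prior ρ t)) • classLaw ρ t +
    ENNReal.ofReal (prior ρ (!t) ^ 2 / (prior ρ (!t) ^ 2 + prior ρ t)) • classLaw ρ (!t)

/-- The law of a similar pair,
`p_S = (π_+² p_+ ⊗ p_+ + π_-² p_- ⊗ p_-) / (π_+² + π_-²)`. -/
def similarLaw (ρ : Measure (X × Bool)) : Measure (X × X) :=
  ENNReal.ofReal (prior ρ true ^ 2 / (prior ρ true ^ 2 + prior ρ false ^ 2)) •
      (classLaw ρ true).prod (classLaw ρ true) +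
    ENNReal.ofReal (prior ρ false ^ 2 / (prior ρ true ^ 2 + prior ρ false ^ 2)) •
      (classLaw ρ false).prod (classLaw ρ false)

/-- The law of a dissimilar pair, `p_D = (p_+ ⊗ p_- + p_- ⊗ p_+) / 2`. -/
def dissimilarLaw (ρ : Measure (X × Bool)) : Measure (X × X) :=
  ENNReal.ofReal (1 / 2) • (classLaw ρ true).prod (classLaw ρ false) +
    ENNReal.ofReal (1 / 2) • (classLaw ρ false).prod (classLaw ρ true)

/-- A law of pairs whose first instance is distributed as the positive comparison mixture and
whose second instance is distributed as the negative one; the coupling of the two is arbitrary. -/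
def HasPcompMarginals (ρ : Measure (X × Bool)) (Q : Measure (X × X)) : Prop :=
  Q.fst = pcompLaw ρ true ∧ Q.snd = pcompLaw ρ false

/-- The coefficient of `ℓ(g(x), y)` in the row vector
`α^S_t = π_t² / (π_+ - π_-) * (π_+, -π_-)`. -/
def weightS (π : Bool → ℝ) (t y : Bool) : ℝ :=
  π t ^ 2 / (π true - π false) * (if y then π true else -π false)

/-- The coefficient of `ℓ(g(x), y)` in the row vector
`α^D_t = 1 / (π_+ - π_-) * (π_- (π_t² - π_{-t}), π_+ (π_{-t} - π_t²))`. -/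
def weightD (π : Bool → ℝ) (t y : Bool) : ℝ :=
  1 / (π true - π false) *
    (if y then π false * (π t ^ 2 - π (!t)) else π true * (π (!t) - π t ^ 2))

/-- The instance `x^+ = x` or `x^- = x'` of a pair `(x, x')`. -/
def inst (t : Bool) (z : X × X) : X := if t then z.1 else z.2

/-- The empirical risk of a sample of pairs with weights `α`:
`∑_t (1/n) ∑_i ∑_y α_t(y) ℓ(g(x_i^t), y)`. -/
def empRiskPart (α : Bool → Bool → ℝ) (ℓ : ℝ → Bool → ℝ) {n : ℕ} (z : Fin n → X × X)
    (g : X → ℝ) : ℝ :=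
  ∑ t : Bool, (1 / (n : ℝ)) * ∑ i, ∑ y : Bool, α t y * ℓ (g (inst t (z i))) y

/-- The empirical risk built from `nS` similar pairs and `nD` dissimilar pairs. -/
def empRisk (π : Bool → ℝ) (ℓ : ℝ → Bool → ℝ) {nS nD : ℕ}
    (zS : Fin nS → X × X) (zD : Fin nD → X × X) (g : X → ℝ) : ℝ :=
  empRiskPart (weightS π) ℓ zS g + empRiskPart (weightD π) ℓ zD g

/-- `g` is a minimizer of `F` over the class `G`. -/
def IsMinimizer (G : Set (X → ℝ)) (F : (X → ℝ) → ℝ) (g : X → ℝ) : Prop :=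
  g ∈ G ∧ ∀ h ∈ G, F g ≤ F h

/-- The Rademacher complexity
`E_{x_1, …, x_n ∼ μ} E_σ [sup_{g ∈ G} (1/n) ∑_i σ_i g(x_i)]`, with `x_1, …, x_n` independent
and the expectation over independent uniform signs written as a finite average. -/
def rademacherComplexity (G : Set (X → ℝ)) (n : ℕ) (μ : Measure X) : ℝ :=
  ∫ x : Fin n → X,
    (1 / (2 : ℝ) ^ n) * ∑ σ : Fin n → ℤˣ,
      ⨆ g : G, (1 / (n : ℝ)) * ∑ i, (((σ i : ℤˣ) : ℤ) : ℝ) * (g : X → ℝ) (x i)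
    ∂(Measure.pi fun _ => μ)

/-- The usual condition that makes suprema over the class measurable: a countable subclass is
sequentially dense for pointwise convergence. -/
def PointwiseSeparable (G : Set (X → ℝ)) : Prop :=
  ∃ G₀ : Set (X → ℝ), G₀ ⊆ G ∧ G₀.Countable ∧
    ∀ g ∈ G, ∃ u : ℕ → X → ℝ, (∀ k, u k ∈ G₀) ∧
      ∀ x, Tendsto (fun k => u k x) atTop (𝓝 (g x))

/-- `Z` is a sample of `n` independent pairs with law `Q`, defined on the probability space
`(Ω, P)`. -/
structure IsIIDSample {Ω : Type*} [MeasurableSpace Ω] (P : Measure Ω) (Q : Measure (X × X))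
    {n : ℕ} (Z : Fin n → Ω → X × X) : Prop where
  indep : iIndepFun Z P
  law : ∀ i, HasLaw (Z i) Q P

/-- With probability at least `1 - δ` over `nS` independent pairs of law `QS` and `nD` independent
pairs of law `QD`, every minimizer `ĝ` of the empirical risk over `G` satisfies
`R(ĝ) - R(g*) ≤ b`. The probability space carrying the samples is arbitrary. -/
def ERMBoundWithProb (ρ : Measure (X × Bool))
    (ℓ : ℝ → Bool → ℝ) (G : Set (X → ℝ)) (QS QD : Measure (X × X)) (gstar : X → ℝ)
    (nS nD : ℕ) (δ b : ℝ) : Prop :=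
  ∀ (Ω : Type w) [MeasurableSpace Ω] (P : Measure Ω) [IsProbabilityMeasure P]
    (S : Fin nS → Ω → X × X) (D : Fin nD → Ω → X × X),
    IsIIDSample P QS S → IsIIDSample P QD D →
      ∃ E : Set Ω, MeasurableSet E ∧ 1 - δ ≤ P.real E ∧
        ∀ ω ∈ E, ∀ ghat : X → ℝ,
          IsMinimizer G (empRisk (prior ρ) ℓ (fun i => S i ω) (fun i => D i ω)) ghat →
            risk ρ ℓ ghat - risk ρ ℓ gstar ≤ b

end SDPcomp

end

/-! The empirical risk is unbiased, and the excess risk is controlled by one-sided uniform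
deviations. Only the two marginals of each pair law enter the expectation of `empRisk`. Since π₊ +
π₋ = 1, every admissible pair law produces the same weighted sums of marginal expectations
(`sum_sq_prior_mul_integral`, `sum_sq_prior_sub_mul_integral`), and these recombine to R. Hence
`risk_sub_empRisk` writes R − R̂ as four centred deviations, one per sample type and position in the
pair.

If ĝ minimizes R̂, then R(ĝ) − R(g*) ≤ (R − R̂)(ĝ) − (R − R̂)(g*), so it suffices to bound dev(g) −
dev(g*) uniformly in g for each of the four. McDiarmid is applied directly to sup dev − dev(g*),
whose mean is E sup dev because dev(g*) is centred. Symmetrization bounds that mean by the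
Rademacher complexities of the weighted loss class and of its negative; contraction reduces both to
that of G. Each deviation gets probability δ/4 and a union bound concludes, so neither the coupling
inside a pair nor the dependence between the two samples matters. The asymptotic statements are the
finite-sample bound at a fixed confidence level. -/

namespace SDPcomp

/-! ### Bounded differences inequality. -/

section McDiarmid

theorem integrable_of_measurable_of_abs_le {α : Type*} [MeasurableSpace α] {μ : Measure α}
    [IsFiniteMeasure μ] {f : α → ℝ} (hf : Measurable f) {B : ℝ} (hB : ∀ x, |f x| ≤ B) :
    Integrable f μ :=
  Integrable.of_bound hf.aestronglyMeasurable B (ae_of_all _ hB)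

theorem abs_integral_le_of_abs_le {α : Type*} [MeasurableSpace α] {μ : Measure α}
    [IsProbabilityMeasure μ] {f : α → ℝ} {B : ℝ} (hB : ∀ x, |f x| ≤ B) :
    |∫ x, f x ∂μ| ≤ B := by
  simpa using norm_integral_le_of_norm_le_const (μ := μ) (f := f) (C := B) (ae_of_all _ hB)

variable {X : Type*} [MeasurableSpace X]

theorem measurable_finCons {n : ℕ} :
    Measurable fun p : X × (Fin n → X) => (Fin.cons p.1 p.2 : Fin (n + 1) → X) := by
  refine measurable_pi_lambda _ fun i => ?_
  refine Fin.cases ?_ (fun j => ?_) i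
  · simpa using measurable_fst
  · simpa [Function.comp_def] using
      (measurable_pi_apply j).comp (measurable_snd (α := X) (β := Fin n → X))

theorem integral_pi_succ (μ : Measure X) [IsProbabilityMeasure μ] {n : ℕ}
    {F : (Fin (n + 1) → X) → ℝ} (hF : Measurable F) {B : ℝ} (hB : ∀ x, |F x| ≤ B) :
    ∫ x, F x ∂(Measure.pi fun _ => μ) =
      ∫ a, ∫ y, F (Fin.cons a y) ∂(Measure.pi fun _ : Fin n => μ) ∂μ := by
  have e := (measurePreserving_piFinSuccAbove (fun _ : Fin (n + 1) => μ) 0).symm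
  rw [← e.integral_comp (MeasurableEquiv.measurableEmbedding _)]
  have key : ∀ p : X × (Fin n → X),
      (MeasurableEquiv.piFinSuccAbove (fun _ : Fin (n + 1) => X) 0).symm p
        = Fin.cons p.1 p.2 := by
    intro p
    simp [MeasurableEquiv.piFinSuccAbove, Fin.insertNthEquiv]
  simp_rw [key]
  exact integral_prod (f := fun p : X × (Fin n → X) => F (Fin.cons p.1 p.2))
    (integrable_of_measurable_of_abs_le (hF.comp measurable_finCons) fun p => hB _)

/-- McDiarmid's inequality, in its moment generating function form. -/
theorem hasSubgaussianMGF_of_boundedDifferences (μ : Measure X) [IsProbabilityMeasure μ]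
    (c : ℝ≥0) {B : ℝ} : ∀ {n : ℕ} {f : (Fin n → X) → ℝ}, Measurable f → (∀ x, |f x| ≤ B) →
      (∀ x i a, |f (Function.update x i a) - f x| ≤ c) →
      HasSubgaussianMGF (fun x => f x - ∫ y, f y ∂(Measure.pi fun _ : Fin n => μ))
        (n * (c / 2) ^ 2) (Measure.pi fun _ : Fin n => μ) := by
  have integrable_exp : ∀ {n : ℕ} {f : (Fin n → X) → ℝ}, Measurable f → (∀ x, |f x| ≤ B) →
      ∀ t m : ℝ, Integrable (fun x => Real.exp (t * (f x - m)))
        (Measure.pi fun _ : Fin n => μ) := by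
    intro n f hf hB t m
    refine integrable_of_measurable_of_abs_le (by fun_prop) (B := Real.exp (|t| * (B + |m|))) ?_
    intro x
    rw [Real.abs_exp, Real.exp_le_exp]
    calc t * (f x - m) ≤ |t * (f x - m)| := le_abs_self _
      _ = |t| * |f x - m| := abs_mul _ _
      _ ≤ |t| * (B + |m|) := by
        gcongr
        exact (abs_sub _ _).trans (by gcongr; exact hB x)
  have hX : Nonempty X := μ.nonempty_of_neZero
  intro n
  induction n with
  | zero =>
    intro f hf hB hc
    have hconst : ∀ x, f x = f default := fun x => congrArg f (Subsingleton.elim _ _)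
    refine ⟨fun t => integrable_exp hf hB t _, fun t => ?_⟩
    have : ∀ x, f x - ∫ y, f y ∂(Measure.pi fun _ : Fin 0 => μ) = 0 := by
      intro x
      simp_rw [hconst]
      simp
    simp [mgf, this]
  | succ n ih =>
    intro f hf hB hc
    refine ⟨fun t => integrable_exp hf hB t _, fun t => ?_⟩
    -- Condition on the first coordinate: f − Ef = (f − h) + (h − Eh). The induction hypothesis
    -- handles the first term for each fixed a, Hoeffding's lemma the second.
    set h : X → ℝ := fun a => ∫ y, f (Fin.cons a y) ∂(Measure.pi fun _ : Fin n => μ) with hh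
    have hfc : ∀ a, Measurable fun y : Fin n → X => f (Fin.cons a y) := fun a =>
      hf.comp (measurable_finCons.comp measurable_prodMk_left)
    have hhm : Measurable h :=
      ((hf.comp measurable_finCons).stronglyMeasurable.integral_prod_right').measurable
    have hhB : ∀ a, |h a| ≤ B := fun a => abs_integral_le_of_abs_le fun y => hB _
    have hEf : ∫ y, f y ∂(Measure.pi fun _ : Fin (n + 1) => μ) = ∫ a, h a ∂μ :=
      integral_pi_succ μ hf hB
    have hdiff : ∀ a b, h a - h b ≤ c := by
      intro a b
      rw [hh]
      simp only
      rw [← integral_sub (integrable_of_measurable_of_abs_le (hfc a) fun y => hB _)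
        (integrable_of_measurable_of_abs_le (hfc b) fun y => hB _)]
      refine (le_abs_self _).trans (abs_integral_le_of_abs_le fun y => ?_)
      simpa using hc (Fin.cons b y) 0 a
    have hbdd : BddBelow (Set.range h) := ⟨-B, by
      rintro _ ⟨a, rfl⟩
      exact (abs_le.1 (hhB a)).1⟩
    -- Since h oscillates by at most c, its values lie in an interval of length c starting at the
    -- infimum; Hoeffding's lemma then adds (c/2)² to the variance proxy.
    have hsub := hasSubgaussianMGF_of_mem_Icc (μ := μ) (X := h) (a := ⨅ a, h a)
      (b := (⨅ a, h a) + c) hhm.aemeasurable (ae_of_all _ fun a => ⟨ciInf_le hbdd a, by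
        have : h a - c ≤ ⨅ a, h a := le_ciInf fun b => by linarith [hdiff a b]
        linarith⟩)
    have hsub' := hsub.mgf_le t
    simp only [mgf, add_sub_cancel_left] at hsub' ⊢
    rw [hEf, integral_pi_succ μ (B := Real.exp (|t| * (B + |∫ a, h a ∂μ|))) (by fun_prop)
      (fun x => by
        rw [Real.abs_exp, Real.exp_le_exp]
        refine (le_abs_self _).trans ?_
        rw [abs_mul]
        gcongr
        exact (abs_sub _ _).trans (by gcongr; exact hB x))]
    have hinner : ∀ a, ∫ y, Real.exp (t * (f (Fin.cons a y) - ∫ a, h a ∂μ))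
        ∂(Measure.pi fun _ : Fin n => μ) ≤
        Real.exp (n * (c / 2) ^ 2 * t ^ 2 / 2) * Real.exp (t * (h a - ∫ a, h a ∂μ)) := by
      intro a
      have := (ih (hfc a) (fun y => hB _) (fun y i b => by
        simpa using hc (Fin.cons a y) i.succ b)).mgf_le t
      simp only [mgf] at this
      push_cast at this
      calc _ = ∫ y, Real.exp (t * (f (Fin.cons a y) - h a)) * Real.exp (t * (h a - ∫ a, h a ∂μ))
            ∂(Measure.pi fun _ : Fin n => μ) := by
            congr 1; ext y; rw [← Real.exp_add]; congr 1; ring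
        _ ≤ _ := by
            rw [integral_mul_const]
            gcongr
    calc _ ≤ ∫ a, Real.exp (n * (c / 2) ^ 2 * t ^ 2 / 2) * Real.exp (t * (h a - ∫ a, h a ∂μ)) ∂μ := by
          refine integral_mono_of_nonneg (ae_of_all _ fun a => integral_nonneg fun y => ?_)
            ((hsub.integrable_exp_mul t).const_mul _) (ae_of_all _ hinner)
          positivity
      _ ≤ Real.exp (n * (c / 2) ^ 2 * t ^ 2 / 2) * Real.exp ((c / 2) ^ 2 * t ^ 2 / 2) := by
          rw [integral_const_mul]
          gcongr
          refine hsub'.trans (le_of_eq ?_)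
          simp
      _ = _ := by
          rw [← Real.exp_add]; congr 1; push_cast; ring

end McDiarmid

/-! ### Ledoux–Talagrand contraction. -/

section Contraction

variable {ι : Type*}

theorem bddAbove_range_of_le {f : ι → ℝ} {B : ℝ} (h : ∀ t, f t ≤ B) :
    BddAbove (Set.range f) := ⟨B, by rintro _ ⟨t, rfl⟩; exact h t⟩

theorem sum_units_int (f : ℤˣ → ℝ) : ∑ s, f s = f 1 + f (-1) := by
  rw [UnitsInt.univ, Finset.sum_pair (by decide)]

theorem abs_unit_mul (s : ℤˣ) (x : ℝ) : |((s : ℤ) : ℝ) * x| = |x| := by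
  rcases Int.units_eq_one_or s with rfl | rfl <;> simp

/-- For near-optimal t and s on the left, φ(v t) − φ(v s) ≤ L|v t − v s|. The two suprema on the
right are over independent indices, so t and s may be exchanged to give the absolute value the right
sign. This is contraction for a single Rademacher sign. -/
theorem ciSup_add_ciSup_le_of_lipschitz [Nonempty ι] {φ : ℝ → ℝ} {L : ℝ≥0}
    (hφ : LipschitzWith L φ) (A v : ι → ℝ) (h₁ : BddAbove (Set.range fun t => A t + L * v t))
    (h₂ : BddAbove (Set.range fun t => A t - L * v t)) :
    (⨆ t, (A t + φ (v t))) + ⨆ t, (A t - φ (v t)) ≤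
      (⨆ t, (A t + L * v t)) + ⨆ t, (A t - L * v t) := by
  have key : ∀ t s, (A t + φ (v t)) + (A s - φ (v s)) ≤
      (⨆ t, (A t + L * v t)) + ⨆ t, (A t - L * v t) := by
    intro t s
    have h := hφ.dist_le_mul (v t) (v s)
    rw [Real.dist_eq, Real.dist_eq] at h
    have h' := (le_abs_self _).trans h
    rcases le_total (v s) (v t) with hv | hv
    · rw [abs_of_nonneg (sub_nonneg.2 hv)] at h'
      have := le_ciSup h₁ t
      have := le_ciSup h₂ s
      linarith
    · rw [abs_of_nonpos (sub_nonpos.2 hv)] at h'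
      have := le_ciSup h₁ s
      have := le_ciSup h₂ t
      linarith
  rw [← le_sub_iff_add_le]
  refine ciSup_le fun t => ?_
  rw [le_sub_iff_add_le, add_comm, ← le_sub_iff_add_le]
  refine ciSup_le fun s => ?_
  linarith [key t s]

theorem sum_fin_succ_units {n : ℕ} (F : (Fin (n + 1) → ℤˣ) → ℝ) :
    ∑ σ, F σ = ∑ s : ℤˣ, ∑ σ : Fin n → ℤˣ, F (Fin.cons s σ) := by
  rw [← Fintype.sum_prod_type']
  exact (Equiv.sum_comp (Fin.consEquiv fun _ => ℤˣ) F).symm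

/-- The Ledoux–Talagrand contraction inequality for suprema without absolute values. -/
theorem sum_signs_ciSup_le_of_lipschitz [Nonempty ι] {φ : ℝ → ℝ} {L : ℝ≥0}
    (hφ : LipschitzWith L φ) {K : ℝ} : ∀ {n : ℕ} (v : Fin n → ι → ℝ), (∀ i t, |v i t| ≤ K) →
      ∀ (A : ι → ℝ) (B : ℝ), (∀ t, |A t| ≤ B) →
      ∑ σ : Fin n → ℤˣ, ⨆ t, (A t + ∑ i, ((σ i : ℤ) : ℝ) * φ (v i t)) ≤
        ∑ σ : Fin n → ℤˣ, ⨆ t, (A t + ∑ i, ((σ i : ℤ) : ℝ) * (L * v i t)) := by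
  intro n
  induction n with
  | zero => intro v hv A B hB; simp
  | succ n ih =>
    intro v hv A B hB
    have hφK : ∀ i t, |φ (v i t)| ≤ |φ 0| + L * K := by
      intro i t
      have h := hφ.dist_le_mul (v i t) 0
      rw [Real.dist_eq, Real.dist_eq, sub_zero] at h
      have h1 := abs_sub_abs_le_abs_sub (φ (v i t)) (φ 0)
      have h2 : (L : ℝ) * |v i t| ≤ L * K := by gcongr; exact hv i t
      linarith
    rw [sum_fin_succ_units, sum_fin_succ_units]
    simp only [Fin.sum_univ_succ, Fin.cons_zero, Fin.cons_succ, ← add_assoc]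
    -- The term of the first sign is absorbed into the arbitrary offset A, so the induction
    -- hypothesis linearizes all other coordinates first.
    refine (Finset.sum_le_sum fun s _ => ih (fun i => v i.succ) (fun i t => hv _ t)
      (fun t => A t + (((s : ℤˣ) : ℤ) : ℝ) * φ (v 0 t)) (B + (|φ 0| + L * K)) fun t => ?_).trans ?_
    · refine (abs_add_le _ _).trans (add_le_add (hB t) ?_)
      rw [abs_unit_mul]
      exact hφK 0 t
    -- Now the remaining signs σ are fixed and the single-sign inequality is applied to coordinate
    -- 0.
    · rw [Finset.sum_comm, Finset.sum_comm (γ := ℤˣ)]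
      refine Finset.sum_le_sum fun σ _ => ?_
      have hS : ∀ t, |∑ i : Fin n, ((σ i : ℤ) : ℝ) * (L * v i.succ t)| ≤ n * (L * K) := by
        intro t
        refine (Finset.abs_sum_le_sum_abs _ _).trans ?_
        refine (Finset.sum_le_card_nsmul _ _ (L * K) fun i _ => ?_).trans (by simp)
        rw [abs_unit_mul, abs_mul, NNReal.abs_eq]
        gcongr
        exact hv _ t
      have hL : ∀ t, |(L : ℝ) * v 0 t| ≤ L * K := fun t => by
        rw [abs_mul, NNReal.abs_eq]
        gcongr
        exact hv _ t
      have hstep := ciSup_add_ciSup_le_of_lipschitz hφ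
        (fun t => A t + ∑ i : Fin n, ((σ i : ℤ) : ℝ) * (L * v i.succ t)) (v 0)
        (bddAbove_range_of_le (B := B + n * (L * K) + L * K) fun t => by
          linarith [le_abs_self (A t), hB t, le_abs_self (L * v 0 t), hL t,
            (le_abs_self _).trans (hS t)])
        (bddAbove_range_of_le (B := B + n * (L * K) + L * K) fun t => by
          linarith [le_abs_self (A t), hB t, neg_abs_le (L * v 0 t), hL t,
            (le_abs_self _).trans (hS t)])
      rw [sum_units_int, sum_units_int]
      refine le_trans (le_of_eq ?_) (hstep.trans (le_of_eq ?_)) <;> congr 1 <;>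
        refine iSup_congr fun t => ?_ <;> push_cast <;> ring

end Contraction

/-! ### Symmetrization by a ghost sample. -/

section Symmetrization

variable {X ι : Type*}

theorem abs_average_le {n : ℕ} (hn : 0 < n) {a : Fin n → ℝ} {M : ℝ} (h : ∀ i, |a i| ≤ M) :
    |(1 / (n : ℝ)) * ∑ i, a i| ≤ M := by
  have hn' : (0 : ℝ) < n := by exact_mod_cast hn
  rw [abs_mul, abs_of_pos (by positivity : (0 : ℝ) < 1 / n), one_div, inv_mul_le_iff₀ hn']
  refine (Finset.abs_sum_le_sum_abs _ _).trans ?_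
  refine (Finset.sum_le_card_nsmul _ _ M fun i _ => h i).trans (by simp)

theorem abs_ciSup_le [Nonempty ι] {f : ι → ℝ} {M : ℝ} (h : ∀ t, |f t| ≤ M) :
    |⨆ t, f t| ≤ M := by
  have t₀ := Classical.arbitrary ι
  exact abs_le.2 ⟨(abs_le.1 (h t₀)).1.trans
    (le_ciSup (bddAbove_range_of_le fun t => (abs_le.1 (h t)).2) t₀),
    ciSup_le fun t => (abs_le.1 (h t)).2⟩

/-- The supremum over a family of the correlation with a fixed vector of signs. -/
noncomputable def signedSup (f : ι → X → ℝ) {n : ℕ} (σ : Fin n → ℤˣ) (x : Fin n → X) : ℝ :=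
  ⨆ t, (1 / (n : ℝ)) * ∑ i, ((σ i : ℤ) : ℝ) * f t (x i)

/-- The supremum over a family of the signed differences over a sample and a ghost sample. -/
noncomputable def ghostSup (f : ι → X → ℝ) {n : ℕ} (σ : Fin n → ℤˣ) (z : Fin n → X × X) : ℝ :=
  ⨆ t, (1 / (n : ℝ)) * ∑ i, ((σ i : ℤ) : ℝ) * (f t (z i).1 - f t (z i).2)

variable {f : ι → X → ℝ} {M : ℝ} {n : ℕ}

theorem abs_signedSup_le [Nonempty ι] (hn : 0 < n) (hM : ∀ t x, |f t x| ≤ M) (σ : Fin n → ℤˣ)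
    (x : Fin n → X) : |signedSup f σ x| ≤ M :=
  abs_ciSup_le fun t => abs_average_le hn fun i => by rw [abs_unit_mul]; exact hM _ _

theorem abs_diff_le_two_mul (hM : ∀ t x, |f t x| ≤ M) (t : ι) (x y : X) :
    |f t x - f t y| ≤ 2 * M := by
  linarith [abs_sub (f t x) (f t y), hM t x, hM t y]

theorem abs_ghostSup_le [Nonempty ι] (hn : 0 < n) (hM : ∀ t x, |f t x| ≤ M) (σ : Fin n → ℤˣ)
    (z : Fin n → X × X) : |ghostSup f σ z| ≤ 2 * M :=
  abs_ciSup_le fun t => abs_average_le hn fun i => by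
    rw [abs_unit_mul]; exact abs_diff_le_two_mul hM _ _ _

theorem ghostSup_le [Nonempty ι] (hn : 0 < n) (hM : ∀ t x, |f t x| ≤ M) (σ : Fin n → ℤˣ)
    (z : Fin n → X × X) : ghostSup f σ z ≤
      signedSup f σ (fun i => (z i).1) + signedSup (fun t x => -f t x) σ (fun i => (z i).2) := by
  refine ciSup_le fun t => ?_
  have h₁ : (1 / (n : ℝ)) * ∑ i, ((σ i : ℤ) : ℝ) * f t (z i).1 ≤
      signedSup f σ (fun i => (z i).1) :=
    le_ciSup (f := fun t => (1 / (n : ℝ)) * ∑ i, ((σ i : ℤ) : ℝ) * f t (z i).1)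
      (bddAbove_range_of_le (B := M) fun t => (le_abs_self _).trans
      (abs_average_le hn fun i => by rw [abs_unit_mul]; exact hM _ _)) t
  have h₂ : (1 / (n : ℝ)) * ∑ i, ((σ i : ℤ) : ℝ) * -f t (z i).2 ≤
      signedSup (fun t x => -f t x) σ (fun i => (z i).2) :=
    le_ciSup (f := fun t => (1 / (n : ℝ)) * ∑ i, ((σ i : ℤ) : ℝ) * -f t (z i).2)
      (bddAbove_range_of_le (B := M) fun t => (le_abs_self _).trans
      (abs_average_le hn fun i => by rw [abs_unit_mul, abs_neg]; exact hM _ _)) t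
  refine le_trans (le_of_eq ?_) (add_le_add h₁ h₂)
  rw [← mul_add, ← Finset.sum_add_distrib]
  congr 1
  exact Finset.sum_congr rfl fun i _ => by ring

/-- Contraction for the average over signs. -/
theorem average_signedSup_comp_le [Nonempty ι] {φ : ℝ → ℝ} {L : ℝ≥0} (hφ : LipschitzWith L φ)
    (hM : ∀ t x, |f t x| ≤ M) (x : Fin n → X) :
    (1 / (2 : ℝ) ^ n) * ∑ σ : Fin n → ℤˣ, signedSup (fun t x => φ (f t x)) σ x ≤
      L * ((1 / (2 : ℝ) ^ n) * ∑ σ : Fin n → ℤˣ, signedSup f σ x) := by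
  have h := sum_signs_ciSup_le_of_lipschitz hφ (fun i t => f t (x i)) (fun i t => hM t (x i))
    (fun _ => 0) 0 (fun _ => by simp)
  simp only [zero_add] at h
  have h1 : ∀ σ : Fin n → ℤˣ, signedSup (fun t x => φ (f t x)) σ x =
      (1 / (n : ℝ)) * ⨆ t, ∑ i, ((σ i : ℤ) : ℝ) * φ (f t (x i)) := fun σ =>
    (Real.mul_iSup_of_nonneg (by positivity) _).symm
  have h2 : ∀ σ : Fin n → ℤˣ, L * signedSup f σ x =
      (1 / (n : ℝ)) * ⨆ t, ∑ i, ((σ i : ℤ) : ℝ) * (L * f t (x i)) := fun σ => by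
    rw [signedSup, Real.mul_iSup_of_nonneg L.coe_nonneg, Real.mul_iSup_of_nonneg (by positivity)]
    refine iSup_congr fun t => ?_
    simp_rw [Finset.mul_sum]
    exact Finset.sum_congr rfl fun i _ => by ring
  rw [mul_left_comm, Finset.mul_sum Finset.univ _ (L : ℝ)]
  simp_rw [h1, h2, ← Finset.mul_sum]
  gcongr

variable [MeasurableSpace X]

theorem measurable_signedSup [Countable ι] (hf : ∀ t, Measurable (f t)) (σ : Fin n → ℤˣ) :
    Measurable (signedSup f σ) := by
  refine Measurable.iSup fun t => Measurable.const_mul (Finset.measurable_sum _ fun i _ => ?_) _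
  exact ((hf t).comp (measurable_pi_apply i)).const_mul _

theorem measurable_ghostSup [Countable ι] (hf : ∀ t, Measurable (f t)) (σ : Fin n → ℤˣ) :
    Measurable (ghostSup f σ) := by
  refine Measurable.iSup fun t => Measurable.const_mul (Finset.measurable_sum _ fun i _ => ?_) _
  exact (((hf t).comp (measurable_fst.comp (measurable_pi_apply i))).sub
    ((hf t).comp (measurable_snd.comp (measurable_pi_apply i)))).const_mul _

/-- Swapping the two members of the pairs with σ i = −1 preserves the product law and flips exactly
those signs. -/
theorem integral_ghostSup_eq [Countable ι] (μ : Measure X) [IsProbabilityMeasure μ]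
    (hf : ∀ t, Measurable (f t)) (σ : Fin n → ℤˣ) :
    ∫ z, ghostSup f (1 : Fin n → ℤˣ) z ∂(Measure.pi fun _ => μ.prod μ) =
      ∫ z, ghostSup f σ z ∂(Measure.pi fun _ => μ.prod μ) := by
  have hT : MeasurePreserving
      (fun (z : Fin n → X × X) i => (if σ i = 1 then id else Prod.swap) (z i))
      (Measure.pi fun _ => μ.prod μ) (Measure.pi fun _ => μ.prod μ) := by
    refine measurePreserving_pi _ _ fun i => ?_
    split_ifs
    · exact MeasurePreserving.id _
    · exact Measure.measurePreserving_swap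
  rw [← hT.map_eq, integral_map hT.measurable.aemeasurable
    (measurable_ghostSup hf 1).aestronglyMeasurable, hT.map_eq]
  congr 1
  ext z
  refine iSup_congr fun t => ?_
  congr 1
  refine Finset.sum_congr rfl fun i _ => ?_
  rcases Int.units_eq_one_or (σ i) with h | h <;> simp [h]

theorem integral_ghostSup_le [Countable ι] [Nonempty ι] (μ : Measure X) [IsProbabilityMeasure μ]
    (hn : 0 < n) (hf : ∀ t, Measurable (f t)) (hM : ∀ t x, |f t x| ≤ M) (σ : Fin n → ℤˣ) :
    ∫ z, ghostSup f σ z ∂(Measure.pi fun _ => μ.prod μ) ≤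
      ∫ x, signedSup f σ x ∂(Measure.pi fun _ => μ) +
        ∫ x, signedSup (fun t x => -f t x) σ x ∂(Measure.pi fun _ => μ) := by
  have hM' : ∀ t x, |-f t x| ≤ M := fun t x => by rw [abs_neg]; exact hM t x
  have h₁ : MeasurePreserving (fun (z : Fin n → X × X) i => (z i).1)
      (Measure.pi fun _ => μ.prod μ) (Measure.pi fun _ => μ) :=
    measurePreserving_pi _ _ fun i => measurePreserving_fst
  have h₂ : MeasurePreserving (fun (z : Fin n → X × X) i => (z i).2)
      (Measure.pi fun _ => μ.prod μ) (Measure.pi fun _ => μ) :=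
    measurePreserving_pi _ _ fun i => measurePreserving_snd
  have m₁ := measurable_signedSup hf σ
  have m₂ : Measurable (signedSup (fun t x => -f t x) σ) :=
    measurable_signedSup (fun t => (hf t).neg) σ
  rw [← h₁.map_eq, integral_map h₁.measurable.aemeasurable m₁.aestronglyMeasurable, h₁.map_eq,
    ← h₂.map_eq, integral_map h₂.measurable.aemeasurable m₂.aestronglyMeasurable, ← integral_add]
  · refine integral_mono (integrable_of_measurable_of_abs_le (measurable_ghostSup hf σ)
      (abs_ghostSup_le hn hM σ)) (Integrable.add ?_ ?_) (ghostSup_le hn hM σ)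
    · exact integrable_of_measurable_of_abs_le (m₁.comp h₁.measurable)
        fun z => abs_signedSup_le hn hM σ _
    · exact integrable_of_measurable_of_abs_le (m₂.comp h₂.measurable)
        fun z => abs_signedSup_le hn hM' σ _
  · exact integrable_of_measurable_of_abs_le (m₁.comp h₁.measurable)
      fun z => abs_signedSup_le hn hM σ _
  · exact integrable_of_measurable_of_abs_le (m₂.comp h₂.measurable)
      fun z => abs_signedSup_le hn hM' σ _

/-- The deviation of the empirical mean of `f` from its expectation. -/
noncomputable def deviation (μ : Measure X) (f : X → ℝ) {n : ℕ} (x : Fin n → X) : ℝ :=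
  ∫ y, f y ∂μ - (1 / (n : ℝ)) * ∑ i, f (x i)

theorem integral_pi_eval (μ : Measure X) [IsProbabilityMeasure μ] {f : X → ℝ}
    (hf : Measurable f) (i : Fin n) :
    ∫ y : Fin n → X, f (y i) ∂(Measure.pi fun _ => μ) = ∫ y, f y ∂μ := by
  have h := measurePreserving_eval (fun _ : Fin n => μ) i
  have h' := integral_map (μ := Measure.pi fun _ : Fin n => μ) h.measurable.aemeasurable
    (f := f) hf.aestronglyMeasurable
  rw [h.map_eq] at h'
  exact h'.symm

/-- The expectation is the mean of a ghost sample average, and a supremum of integrals is at most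
the integral of the supremum. -/
theorem iSup_deviation_le [Countable ι] [Nonempty ι] (μ : Measure X) [IsProbabilityMeasure μ]
    (hn : 0 < n) (hf : ∀ t, Measurable (f t)) (hM : ∀ t x, |f t x| ≤ M) (x : Fin n → X) :
    ⨆ t, deviation μ (f t) x ≤
      ∫ y, ghostSup f 1 (fun i => (y i, x i)) ∂(Measure.pi fun _ => μ) := by
  refine ciSup_le fun t => ?_
  have hn' : (n : ℝ) ≠ 0 := by exact_mod_cast hn.ne'
  have hint : ∀ i : Fin n, Integrable (fun y : Fin n → X => f t (y i))
      (Measure.pi fun _ => μ) := fun i =>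
    integrable_of_measurable_of_abs_le ((hf t).comp (measurable_pi_apply i)) fun y => hM _ _
  have hmean : deviation μ (f t) x =
      ∫ y, (1 / (n : ℝ)) * ∑ i, (((1 : Fin n → ℤˣ) i : ℤ) : ℝ) * (f t (y i) - f t (x i))
        ∂(Measure.pi fun _ => μ) := by
    simp only [Pi.one_apply, Units.val_one, Int.cast_one, one_mul]
    rw [integral_const_mul, integral_finsetSum _ fun i _ =>
      (hint i).sub' (integrable_const _)]
    simp_rw [integral_sub (hint _) (integrable_const _), integral_pi_eval μ (hf t)]
    simp [deviation, mul_sub, hn']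
  rw [hmean]
  have hle : ∀ y : Fin n → X,
      (1 / (n : ℝ)) * ∑ i, (((1 : Fin n → ℤˣ) i : ℤ) : ℝ) * (f t (y i) - f t (x i)) ≤
        ghostSup f 1 (fun i => (y i, x i)) := fun y =>
    le_ciSup (f := fun t => (1 / (n : ℝ)) * ∑ i,
        (((1 : Fin n → ℤˣ) i : ℤ) : ℝ) * (f t (y i) - f t (x i)))
      (bddAbove_range_of_le (B := 2 * M) fun t => (le_abs_self _).trans
      (abs_average_le hn fun i => by rw [abs_unit_mul]; exact abs_diff_le_two_mul hM _ _ _)) t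
  refine integral_mono ?_ ?_ hle
  · refine integrable_of_measurable_of_abs_le (B := 2 * M) ?_ fun y =>
      abs_average_le hn fun i => by rw [abs_unit_mul]; exact abs_diff_le_two_mul hM _ _ _
    exact (Finset.measurable_sum _ fun i _ =>
      (((hf t).comp (measurable_pi_apply i)).sub_const _).const_mul _).const_mul _
  · refine integrable_of_measurable_of_abs_le ((measurable_ghostSup hf 1).comp ?_)
      fun y => abs_ghostSup_le hn hM 1 _
    exact measurable_pi_lambda _ fun i => (measurable_pi_apply i).prodMk measurable_const

theorem measurable_deviation (μ : Measure X) {f : X → ℝ} (hf : Measurable f) :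
    Measurable (deviation μ f (n := n)) :=
  (Measurable.const_mul (Finset.measurable_sum _ fun i _ =>
    hf.comp (measurable_pi_apply i)) _).const_sub _

/-- The deviation averages integrals of f y − f (x i), so the oscillation C bounds it; M serves only
for integrability. -/
theorem abs_deviation_le (μ : Measure X) [IsProbabilityMeasure μ] (hn : 0 < n) {f : X → ℝ}
    (hf : Measurable f) (hM : ∀ x, |f x| ≤ M) {C : ℝ} (hC : ∀ x y, |f x - f y| ≤ C)
    (x : Fin n → X) : |deviation μ f x| ≤ C := by
  have hn' : (n : ℝ) ≠ 0 := by exact_mod_cast hn.ne'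
  have : deviation μ f x = (1 / (n : ℝ)) * ∑ i, ∫ y, (f y - f (x i)) ∂μ := by
    simp_rw [integral_sub (integrable_of_measurable_of_abs_le hf hM) (integrable_const _)]
    simp [deviation, mul_sub, hn']
  rw [this]
  exact abs_average_le hn fun i => abs_integral_le_of_abs_le fun y => hC _ _

/-- Symmetrization: the expected uniform deviation is at most the sum of the Rademacher
complexities of the family and of its negative. -/
theorem integral_iSup_deviation_le [Countable ι] [Nonempty ι] (μ : Measure X)
    [IsProbabilityMeasure μ] (hn : 0 < n) (hf : ∀ t, Measurable (f t))
    (hM : ∀ t x, |f t x| ≤ M) :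
    ∫ x, ⨆ t, deviation μ (f t) x ∂(Measure.pi fun _ : Fin n => μ) ≤
      ∫ x, (1 / (2 : ℝ) ^ n) * ∑ σ : Fin n → ℤˣ, signedSup f σ x ∂(Measure.pi fun _ => μ) +
      ∫ x, (1 / (2 : ℝ) ^ n) * ∑ σ : Fin n → ℤˣ, signedSup (fun t x => -f t x) σ x
        ∂(Measure.pi fun _ => μ) := by
  have hM' : ∀ t x, |-f t x| ≤ M := fun t x => by rw [abs_neg]; exact hM t x
  have hf' : ∀ t, Measurable fun x => -f t x := fun t => (hf t).neg
  have e := measurePreserving_arrowProdEquivProdArrow X X (Fin n) (fun _ => μ) (fun _ => μ)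
  have hpair : Measurable fun p : (Fin n → X) × (Fin n → X) => fun i => (p.2 i, p.1 i) :=
    measurable_pi_lambda _ fun i => ((measurable_pi_apply i).comp measurable_snd).prodMk
      ((measurable_pi_apply i).comp measurable_fst)
  have hgi : Integrable (fun p : (Fin n → X) × (Fin n → X) =>
      ghostSup f 1 fun i => (p.2 i, p.1 i))
      ((Measure.pi fun _ => μ).prod (Measure.pi fun _ => μ)) :=
    integrable_of_measurable_of_abs_le ((measurable_ghostSup hf 1).comp hpair)
      fun y => abs_ghostSup_le hn hM 1 _
  have h1 : ∫ x, ⨆ t, deviation μ (f t) x ∂(Measure.pi fun _ : Fin n => μ) ≤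
      ∫ z, ghostSup f (1 : Fin n → ℤˣ) z ∂(Measure.pi fun _ => μ.prod μ) := by
    calc _ ≤ ∫ x, ∫ y, ghostSup f 1 (fun i => (y i, x i)) ∂(Measure.pi fun _ => μ)
            ∂(Measure.pi fun _ => μ) := by
          refine integral_mono ?_ hgi.integral_prod_left fun x =>
            iSup_deviation_le μ hn hf hM x
          exact integrable_of_measurable_of_abs_le
            (Measurable.iSup fun t => measurable_deviation μ (hf t))
            fun x => abs_ciSup_le fun t =>
              abs_deviation_le μ hn (hf t) (hM t) (abs_diff_le_two_mul hM t) x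
      -- In a pair z the observed point comes first and the ghost point second, opposite to the
      -- order inside `ghostSup f 1`; this reverses every sign.
      _ = ∫ z, ghostSup f (-1) z ∂(Measure.pi fun _ => μ.prod μ) := by
          rw [← integral_prod (f := fun p : (Fin n → X) × (Fin n → X) =>
            ghostSup f 1 fun i => (p.2 i, p.1 i)) hgi, ← e.integral_comp'
            (g := fun p : (Fin n → X) × (Fin n → X) => ghostSup f 1 fun i => (p.2 i, p.1 i))]
          congr 1
          ext z
          refine iSup_congr fun t => ?_
          simp [MeasurableEquiv.arrowProdEquivProdArrow, Equiv.arrowProdEquivProdArrow]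
      _ = _ := (integral_ghostSup_eq μ hf (-1)).symm
  refine h1.trans ?_
  -- All sign vectors give the same integral, so it equals its average over them.
  have h2 : ∫ z, ghostSup f (1 : Fin n → ℤˣ) z ∂(Measure.pi fun _ => μ.prod μ) =
      (1 / (2 : ℝ) ^ n) * ∑ σ : Fin n → ℤˣ,
        ∫ z, ghostSup f σ z ∂(Measure.pi fun _ => μ.prod μ) := by
    simp_rw [← integral_ghostSup_eq μ hf]
    simp
  rw [h2, integral_const_mul, integral_const_mul, integral_finsetSum _ fun σ _ =>
    integrable_of_measurable_of_abs_le (measurable_signedSup hf σ) (abs_signedSup_le hn hM σ),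
    integral_finsetSum _ fun σ _ => integrable_of_measurable_of_abs_le
      (measurable_signedSup hf' σ) (abs_signedSup_le hn hM' σ), ← mul_add,
    ← Finset.sum_add_distrib]
  gcongr with σ
  exact integral_ghostSup_le μ hn hf hM σ

end Symmetrization

/-! ### High-probability uniform deviation bounds. -/

section UniformDeviation

variable {X : Type*}

theorem signedSup_eq_of_dense {G G₀ : Set (X → ℝ)} (hG₀ : G₀ ⊆ G) [Nonempty G₀]
    (hd : ∀ g ∈ G, ∃ u : ℕ → X → ℝ, (∀ k, u k ∈ G₀) ∧
      ∀ x, Tendsto (fun k => u k x) atTop (𝓝 (g x)))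
    {Cg : ℝ} (hbdd : ∀ g ∈ G, ∀ x, |g x| ≤ Cg) {n : ℕ} (hn : 0 < n) (σ : Fin n → ℤˣ)
    (x : Fin n → X) :
    signedSup (fun g : G => (g : X → ℝ)) σ x = signedSup (fun g : G₀ => (g : X → ℝ)) σ x := by
  have : Nonempty G := ⟨⟨_, hG₀ (Classical.arbitrary G₀).2⟩⟩
  have hb : ∀ g ∈ G, (1 / (n : ℝ)) * ∑ i, ((σ i : ℤ) : ℝ) * g (x i) ≤ Cg := fun g hg =>
    (le_abs_self _).trans (abs_average_le hn fun i => by rw [abs_unit_mul]; exact hbdd g hg _)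
  apply le_antisymm
  · refine ciSup_le fun g => ?_
    obtain ⟨v, hv, hlim⟩ := hd g g.2
    refine le_of_tendsto (f := fun k => (1 / (n : ℝ)) * ∑ i, ((σ i : ℤ) : ℝ) * v k (x i))
      (Tendsto.const_mul _ (tendsto_finsetSum _ fun i _ => (hlim (x i)).const_mul _))
      (Eventually.of_forall fun k => ?_)
    exact le_ciSup (f := fun g : G₀ => (1 / (n : ℝ)) * ∑ i, ((σ i : ℤ) : ℝ) * (g : X → ℝ) (x i))
      (bddAbove_range_of_le fun g => hb g (hG₀ g.2)) ⟨v k, hv k⟩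
  · exact ciSup_le fun g => le_ciSup
      (f := fun g : G => (1 / (n : ℝ)) * ∑ i, ((σ i : ℤ) : ℝ) * (g : X → ℝ) (x i))
      (bddAbove_range_of_le fun g => hb g g.2) ⟨g, hG₀ g.2⟩

theorem sum_signs_linear_eq_zero {n : ℕ} (c : Fin n → ℝ) :
    ∑ σ : Fin n → ℤˣ, (1 / (n : ℝ)) * ∑ i, ((σ i : ℤ) : ℝ) * c i = 0 := by
  have h := Equiv.sum_comp (Equiv.neg (Fin n → ℤˣ))
    fun σ => (1 / (n : ℝ)) * ∑ i, ((σ i : ℤ) : ℝ) * c i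
  simp only [Equiv.neg_apply, Pi.neg_apply, Units.val_neg, Int.cast_neg, neg_mul,
    Finset.sum_neg_distrib, mul_neg] at h
  linarith

variable [MeasurableSpace X]

/-- The supremum dominates one fixed member, whose signed averages cancel under σ ↦ −σ. -/
theorem rademacherComplexity_nonneg {G : Set (X → ℝ)} (hG : G.Nonempty)
    {Cg : ℝ} (hbdd : ∀ g ∈ G, ∀ x, |g x| ≤ Cg) {n : ℕ} (hn : 0 < n) (μ : Measure X) :
    0 ≤ rademacherComplexity G n μ := by
  obtain ⟨g, hg⟩ := hG
  refine integral_nonneg fun x => mul_nonneg (by positivity) ?_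
  rw [← sum_signs_linear_eq_zero fun i => g (x i)]
  refine Finset.sum_le_sum fun σ _ => ?_
  exact le_ciSup (f := fun g : G => (1 / (n : ℝ)) * ∑ i, ((σ i : ℤ) : ℝ) * (g : X → ℝ) (x i))
    (bddAbove_range_of_le fun g => (le_abs_self _).trans (abs_average_le hn fun i => by
      rw [abs_unit_mul]; exact hbdd g g.2 _)) ⟨g, hg⟩

theorem integral_average_signedSup_comp_le {ι : Type*} [Countable ι] [Nonempty ι]
    (μ : Measure X) [IsProbabilityMeasure μ] {g : ι → X → ℝ} (hg : ∀ t, Measurable (g t))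
    {Cg : ℝ} (hbdd : ∀ t x, |g t x| ≤ Cg) {φ : ℝ → ℝ} {L : ℝ≥0} (hφ : LipschitzWith L φ)
    {M : ℝ} (hM : ∀ t x, |φ (g t x)| ≤ M) {n : ℕ} (hn : 0 < n) :
    ∫ x, (1 / (2 : ℝ) ^ n) * ∑ σ : Fin n → ℤˣ, signedSup (fun t x => φ (g t x)) σ x
        ∂(Measure.pi fun _ => μ) ≤
      L * ∫ x, (1 / (2 : ℝ) ^ n) * ∑ σ : Fin n → ℤˣ, signedSup g σ x
        ∂(Measure.pi fun _ => μ) := by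
  rw [← integral_const_mul]
  refine integral_mono ?_ ?_ fun x => average_signedSup_comp_le hφ hbdd x
  · exact (integrable_finsetSum _ fun σ _ => integrable_of_measurable_of_abs_le
      (measurable_signedSup (fun t => hφ.continuous.measurable.comp (hg t)) σ)
      (abs_signedSup_le hn hM σ)).const_mul _
  · exact ((integrable_finsetSum _ fun σ _ => integrable_of_measurable_of_abs_le
      (measurable_signedSup hg σ) (abs_signedSup_le hn hbdd σ)).const_mul _).const_mul _

theorem abs_deviation_update_sub_le (μ : Measure X) {f : X → ℝ} {C : ℝ}
    (hC : ∀ x y, |f x - f y| ≤ C) {n : ℕ} (x : Fin n → X) (i : Fin n) (a : X) :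
    |deviation μ f (Function.update x i a) - deviation μ f x| ≤ C / n := by
  have : deviation μ f (Function.update x i a) - deviation μ f x =
      (1 / (n : ℝ)) * (f (x i) - f a) := by
    have h : ∑ j, f (Function.update x i a j) - ∑ j, f (x j) = f a - f (x i) := by
      rw [← Finset.sum_sub_distrib, Finset.sum_eq_single i]
      · simp
      · intro j _ hj
        simp [Function.update_of_ne hj]
      · simp
    rw [deviation, deviation]
    linear_combination -(1 / (n : ℝ)) * h
  rw [this, abs_mul, abs_of_nonneg (by positivity : (0 : ℝ) ≤ 1 / n), one_div, div_eq_inv_mul]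
  gcongr
  exact hC _ _

theorem ciSup_sub_ciSup_le {ι : Type*} [Nonempty ι] {a b : ι → ℝ} {c : ℝ}
    (hb : BddAbove (Set.range b)) (h : ∀ t, a t - b t ≤ c) : (⨆ t, a t) - ⨆ t, b t ≤ c := by
  rw [sub_le_iff_le_add]
  exact ciSup_le fun t => by linarith [h t, le_ciSup hb t]

/-- The excess of the uniform deviation of a countable family over the deviation of a fixed
function is, with high probability, at most its mean plus a bounded differences term. -/
theorem measureReal_iSup_deviation_sub_ge_le {ι : Type*} [Countable ι] [Nonempty ι]
    (μ : Measure X) [IsProbabilityMeasure μ] {f : ι → X → ℝ} {fs : X → ℝ}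
    (hf : ∀ t, Measurable (f t)) (hfs : Measurable fs) {M C : ℝ} (hM : ∀ t x, |f t x| ≤ M)
    (hMs : ∀ x, |fs x| ≤ M) (hC : ∀ t x y, |f t x - f t y| ≤ C)
    (hCs : ∀ x y, |fs x - fs y| ≤ C) (hC0 : 0 < C) {n : ℕ} (hn : 0 < n)
    {δ : ℝ} (hδ : 0 < δ) (hδ1 : δ < 1) :
    (Measure.pi fun _ : Fin n => μ).real
      {x | (∫ x, ⨆ t, deviation μ (f t) x ∂(Measure.pi fun _ : Fin n => μ)) +
        2 * C * √(Real.log (1 / δ) / (2 * n)) ≤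
          (⨆ t, deviation μ (f t) x) - deviation μ fs x} ≤ δ := by
  have hn' : (0 : ℝ) < n := by exact_mod_cast hn
  have hsup := fun x => abs_ciSup_le fun t => abs_deviation_le μ hn (hf t) (hM t) (hC t) x
  have hdev := abs_deviation_le μ hn hfs hMs hCs
  have hmsup : Measurable fun x : Fin n → X => ⨆ t, deviation μ (f t) x :=
    Measurable.iSup fun t => measurable_deviation μ (hf t)
  have hmdev : Measurable (deviation μ fs (n := n)) := measurable_deviation μ hfs
  have hzero : ∫ x, deviation μ fs x ∂(Measure.pi fun _ : Fin n => μ) = 0 := by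
    have hi : ∀ i : Fin n, Integrable (fun y : Fin n → X => fs (y i)) (Measure.pi fun _ => μ) :=
      fun i => integrable_of_measurable_of_abs_le (hfs.comp (measurable_pi_apply i))
        fun y => hMs _
    simp only [deviation]
    rw [integral_sub (integrable_const _) ((integrable_finsetSum _ fun i _ => hi i).const_mul _),
      integral_const_mul, integral_finsetSum _ fun i _ => hi i]
    simp [integral_pi_eval μ hfs, hn'.ne']
  -- Changing one point moves the supremum by at most C/n and the deviation of `fs` by at most C/n,
  -- hence 2C/n.
  obtain ⟨c, hc⟩ : ∃ c : ℝ≥0, (c : ℝ) = 2 * C / n :=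
    ⟨⟨2 * C / n, by positivity⟩, rfl⟩
  have hsub := hasSubgaussianMGF_of_boundedDifferences μ c
    (f := fun x : Fin n → X => (⨆ t, deviation μ (f t) x) - deviation μ fs x) (B := 2 * C)
    (hmsup.sub hmdev) (fun x => by
      have h := abs_sub (iSup fun t => deviation μ (f t) x) (deviation μ fs x)
      linarith [hsup x, hdev x]) (fun x i a => by
      have hb : ∀ x : Fin n → X, BddAbove (Set.range fun t => deviation μ (f t) x) := fun x =>
        bddAbove_range_of_le fun t => (le_abs_self _).trans
          (abs_deviation_le μ hn (hf t) (hM t) (hC t) x)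
      have hs := abs_le.1 (abs_deviation_update_sub_le μ hCs x i a)
      have h1 := ciSup_sub_ciSup_le (hb x) fun t =>
        (abs_le.1 (abs_deviation_update_sub_le μ (hC t) x i a)).2
      have h2 := ciSup_sub_ciSup_le (hb (Function.update x i a)) (c := C / n)
        (a := fun t => deviation μ (f t) x) fun t => by
        linarith [(abs_le.1 (abs_deviation_update_sub_le μ (hC t) x i a)).1]
      have h3 : (c : ℝ) = C / n + C / n := by rw [hc]; ring
      rw [h3, abs_le]
      constructor <;> linarith)
  have hlog : 0 < Real.log (1 / δ) := Real.log_pos (by rw [lt_div_iff₀ hδ]; linarith)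
  have htail := hsub.measure_ge_le (ε := 2 * C * √(Real.log (1 / δ) / (2 * n))) (by positivity)
  rw [integral_sub (integrable_of_measurable_of_abs_le hmsup hsup)
    (integrable_of_measurable_of_abs_le hmdev hdev), hzero, sub_zero] at htail
  -- The variance proxy is n(c/2)² = C²/n; the threshold is chosen so that the tail exponent is
  -- exactly log δ.
  have hexp : -(2 * C * √(Real.log (1 / δ) / (2 * n))) ^ 2 /
      (2 * ((n * (c / 2) ^ 2 : ℝ≥0) : ℝ)) = Real.log δ := by
    rw [mul_pow, Real.sq_sqrt (by positivity)]
    push_cast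
    rw [hc, one_div, Real.log_inv]
    field_simp
  rw [hexp, Real.exp_log hδ] at htail
  refine le_trans (measureReal_mono fun x hx => ?_) htail
  simp only [Set.mem_ofPred_eq] at hx ⊢
  linarith

/-- A uniform one-sided deviation bound, relative to a fixed member `gs` of the class, for the
empirical means of `φ ∘ g` over a class `G` of bounded functions. -/
theorem measureReal_exists_deviation_gt_le (μ : Measure X) [IsProbabilityMeasure μ]
    {G : Set (X → ℝ)} (hGmeas : ∀ g ∈ G, Measurable g) (hGsep : PointwiseSeparable G) {Cg : ℝ}
    (hGbdd : ∀ g ∈ G, ∀ x, |g x| ≤ Cg) {φ : ℝ → ℝ} {L : ℝ≥0} (hφ : LipschitzWith L φ) {C : ℝ}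
    (hC : ∀ z z', |z| ≤ Cg → |z'| ≤ Cg → |φ z - φ z'| ≤ C) {n : ℕ} (hn : 0 < n)
    {gs : X → ℝ} (hgs : gs ∈ G) {δ : ℝ} (hδ : 0 < δ) (hδ1 : δ < 1) :
    (Measure.pi fun _ : Fin n => μ).real
      {x | ∃ g ∈ G, 2 * L * rademacherComplexity G n μ +
          2 * C * √(Real.log (1 / δ) / (2 * n)) <
        deviation μ (fun y => φ (g y)) x - deviation μ (fun y => φ (gs y)) x} ≤ δ := by
  obtain ⟨G₀, hG₀, hcount, hd⟩ := hGsep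
  have hne : Nonempty G₀ := by
    obtain ⟨v, hv, -⟩ := hd gs hgs
    exact ⟨⟨v 0, hv 0⟩⟩
  have hcount' : Countable G₀ := hcount.to_subtype
  have hX : Nonempty X := μ.nonempty_of_neZero
  have hC0 : 0 ≤ C := by
    have x := Classical.arbitrary X
    exact (abs_nonneg _).trans (hC _ _ (hGbdd gs hgs x) (hGbdd gs hgs x))
  have hφM : ∀ g ∈ G, ∀ x, |φ (g x)| ≤ |φ 0| + L * Cg := by
    intro g hg x
    have h := hφ.dist_le_mul (g x) 0
    rw [Real.dist_eq, Real.dist_eq, sub_zero] at h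
    have h1 := abs_sub_abs_le_abs_sub (φ (g x)) (φ 0)
    have h2 : (L : ℝ) * |g x| ≤ L * Cg := by gcongr; exact hGbdd g hg x
    linarith
  have hφm : ∀ g ∈ G, Measurable fun x => φ (g x) := fun g hg =>
    hφ.continuous.measurable.comp (hGmeas g hg)
  have hφC : ∀ g ∈ G, ∀ x y, |φ (g x) - φ (g y)| ≤ C := fun g hg x y =>
    hC _ _ (hGbdd g hg x) (hGbdd g hg y)
  -- For C = 0 the tail exponent would divide by zero, but then all deviations vanish.
  rcases hC0.eq_or_lt with rfl | hC0
  · have hdev0 : ∀ g ∈ G, ∀ x : Fin n → X, deviation μ (fun y => φ (g y)) x = 0 := fun g hg x =>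
      abs_nonpos_iff.1 (abs_deviation_le μ hn (hφm g hg) (hφM g hg) (hφC g hg) x)
    have hempty : {x : Fin n → X | ∃ g ∈ G, 2 * L * rademacherComplexity G n μ +
          2 * 0 * √(Real.log (1 / δ) / (2 * n)) <
        deviation μ (fun y => φ (g y)) x - deviation μ (fun y => φ (gs y)) x} = ∅ := by
      refine Set.eq_empty_of_forall_notMem ?_
      rintro x ⟨g, hg, hlt⟩
      rw [hdev0 g hg, hdev0 gs hgs] at hlt
      have := rademacherComplexity_nonneg ⟨gs, hgs⟩ hGbdd hn μ
      have : 0 ≤ 2 * L * rademacherComplexity G n μ := by positivity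
      linarith
    rw [hempty]
    simpa using hδ.le
  let f : G₀ → X → ℝ := fun g x => φ ((g : X → ℝ) x)
  have hrad : rademacherComplexity G n μ = ∫ x, (1 / (2 : ℝ) ^ n) *
      ∑ σ : Fin n → ℤˣ, signedSup (fun g : G₀ => (g : X → ℝ)) σ x ∂(Measure.pi fun _ => μ) := by
    simp_rw [← signedSup_eq_of_dense hG₀ hd hGbdd hn]
    rfl
  have hmean : ∫ x, ⨆ t, deviation μ (f t) x ∂(Measure.pi fun _ : Fin n => μ) ≤
      2 * L * rademacherComplexity G n μ := by
    have h1 := integral_iSup_deviation_le μ hn (f := f) (fun t => hφm t (hG₀ t.2))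
      (fun t => hφM t (hG₀ t.2))
    have h2 := integral_average_signedSup_comp_le μ (g := fun g : G₀ => (g : X → ℝ))
      (fun t => hGmeas t (hG₀ t.2)) (fun t => hGbdd t (hG₀ t.2)) hφ
      (fun t => hφM t (hG₀ t.2)) hn
    -- The negated class comes from contracting with −φ, again L-Lipschitz, so G need not be
    -- symmetric.
    have h3 := integral_average_signedSup_comp_le μ (g := fun g : G₀ => (g : X → ℝ))
      (fun t => hGmeas t (hG₀ t.2)) (fun t => hGbdd t (hG₀ t.2)) hφ.neg
      (M := |φ 0| + L * Cg)
      (fun t x => by simpa using hφM t (hG₀ t.2) x) hn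
    rw [← hrad] at h2 h3
    simp only [Pi.neg_apply] at h3
    linarith
  refine le_trans (measureReal_mono ?_) (measureReal_iSup_deviation_sub_ge_le μ (f := f)
    (fun t => hφm t (hG₀ t.2)) (hφm gs hgs) (fun t => hφM t (hG₀ t.2)) (hφM gs hgs)
    (fun t => hφC t (hG₀ t.2)) (hφC gs hgs) hC0 hn hδ hδ1)
  rintro x ⟨g, hg, hlt⟩
  obtain ⟨v, hv, hlim⟩ := hd g hg
  have hφlim : ∀ y, Tendsto (fun k => φ (v k y)) atTop (𝓝 (φ (g y))) := fun y =>
    (hφ.continuous.tendsto _).comp (hlim y)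
  -- A member of G is a pointwise limit of members of the countable subclass; its deviation is the
  -- limit of theirs, by dominated convergence for the mean.
  have hle : deviation μ (fun y => φ (g y)) x ≤ ⨆ t, deviation μ (f t) x := by
    refine le_of_tendsto (f := fun k => deviation μ (fun y => φ (v k y)) x) (Tendsto.sub ?_
      (Tendsto.const_mul _ (tendsto_finsetSum _ fun i _ => hφlim (x i))))
      (Eventually.of_forall fun k => ?_)
    · exact tendsto_integral_of_dominated_convergence (fun _ => |φ 0| + L * Cg)
        (fun k => (hφm _ (hG₀ (hv k))).aestronglyMeasurable) (integrable_const _)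
        (fun k => ae_of_all _ (hφM _ (hG₀ (hv k)))) (ae_of_all _ hφlim)
    · exact le_ciSup (f := fun t => deviation μ (f t) x) (bddAbove_range_of_le fun t =>
        (le_abs_self _).trans (abs_deviation_le μ hn (hφm t (hG₀ t.2)) (hφM t (hG₀ t.2))
          (hφC t (hG₀ t.2)) x)) ⟨v k, hv k⟩
  simp only [Set.mem_ofPred_eq]
  linarith

theorem measureReal_exists_sample_deviation_gt_le {Ω : Type*} [MeasurableSpace Ω]
    {P : Measure Ω} [IsProbabilityMeasure P] (μ : Measure X) [IsProbabilityMeasure μ]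
    {G : Set (X → ℝ)} (hGmeas : ∀ g ∈ G, Measurable g) (hGsep : PointwiseSeparable G) {Cg : ℝ}
    (hGbdd : ∀ g ∈ G, ∀ x, |g x| ≤ Cg) {φ : ℝ → ℝ} {L : ℝ≥0} (hφ : LipschitzWith L φ) {C : ℝ}
    (hC : ∀ z z', |z| ≤ Cg → |z'| ≤ Cg → |φ z - φ z'| ≤ C) {n : ℕ} (hn : 0 < n)
    {gs : X → ℝ} (hgs : gs ∈ G) {δ : ℝ} (hδ : 0 < δ) (hδ1 : δ < 1) {r : ℝ}
    (hr : rademacherComplexity G n μ ≤ r) {x : Fin n → Ω → X} (hindep : iIndepFun x P)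
    (hlaw : ∀ i, HasLaw (x i) μ P) :
    P.real {ω | ∃ g ∈ G, 2 * L * r + 2 * C * √(Real.log (1 / δ) / (2 * n)) <
        deviation μ (fun y => φ (g y)) (fun i => x i ω) -
          deviation μ (fun y => φ (gs y)) (fun i => x i ω)} ≤ δ := by
  have hmap : P.map (fun ω i => x i ω) = Measure.pi fun _ => μ := by
    rw [(iIndepFun_iff_map_fun_eq_pi_map fun i => (hlaw i).aemeasurable).1 hindep]
    simp_rw [(hlaw _).map_eq]
  have haem : AEMeasurable (fun ω i => x i ω) P :=
    aemeasurable_pi_lambda _ fun i => (hlaw i).aemeasurable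
  have h := measureReal_exists_deviation_gt_le μ hGmeas hGsep hGbdd hφ hC hn hgs hδ hδ1
  rw [← hmap] at h
  set B := {y : Fin n → X | ∃ g ∈ G, 2 * L * rademacherComplexity G n μ +
          2 * C * √(Real.log (1 / δ) / (2 * n)) <
        deviation μ (fun z => φ (g z)) y - deviation μ (fun z => φ (gs z)) y} with hB
  have : IsProbabilityMeasure (P.map fun ω i => x i ω) := Measure.isProbabilityMeasure_map haem
  -- The set B is defined by an existential over a possibly uncountable class, so only this
  -- inequality, valid for arbitrary sets, is used.
  have hle : P ((fun ω i => x i ω) ⁻¹' B) ≤ P.map (fun ω i => x i ω) B :=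
    Measure.le_map_apply haem B
  refine le_trans (measureReal_mono ?_) ((ENNReal.toReal_mono (measure_ne_top _ _) hle).trans h)
  rintro ω ⟨g, hg, hlt⟩
  refine ⟨g, hg, lt_of_le_of_lt ?_ hlt⟩
  gcongr

end UniformDeviation

/-! ### Class mixtures and unbiasedness of the empirical risk. -/

section Unbiasedness

variable {X : Type*}

theorem compl_label_eq (t : Bool) : {p : X × Bool | p.2 = t}ᶜ = {p | p.2 = !t} := by
  ext p
  rcases p with ⟨x, b⟩
  cases b <;> cases t <;> simp

/-- The loss charged to one instance of a pair: `κ (p ℓ(z, +1) - q ℓ(z, -1))`. -/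
noncomputable def weightedLoss (ℓ : ℝ → Bool → ℝ) (κ p q z : ℝ) : ℝ :=
  κ * (p * ℓ z true - q * ℓ z false)

theorem empRiskPart_weightS (π : Bool → ℝ) (ℓ : ℝ → Bool → ℝ) {n : ℕ} (z : Fin n → X × X)
    (g : X → ℝ) :
    empRiskPart (weightS π) ℓ z g = ∑ t : Bool, (1 / (n : ℝ)) * ∑ i,
      weightedLoss ℓ (π t ^ 2 / (π true - π false)) (π true) (π false) (g (inst t (z i))) := by
  refine Finset.sum_congr rfl fun t _ => ?_
  congr 1
  refine Finset.sum_congr rfl fun i _ => ?_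
  simp [weightS, weightedLoss]
  ring

theorem empRiskPart_weightD (π : Bool → ℝ) (ℓ : ℝ → Bool → ℝ) {n : ℕ} (z : Fin n → X × X)
    (g : X → ℝ) :
    empRiskPart (weightD π) ℓ z g = ∑ t : Bool, (1 / (n : ℝ)) * ∑ i,
      weightedLoss ℓ ((π t ^ 2 - π (!t)) / (π true - π false)) (π false) (π true)
        (g (inst t (z i))) := by
  refine Finset.sum_congr rfl fun t _ => ?_
  congr 1
  refine Finset.sum_congr rfl fun i _ => ?_
  simp [weightD, weightedLoss]
  ring

variable [MeasurableSpace X]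

theorem measurableSet_label_eq (t : Bool) : MeasurableSet {p : X × Bool | p.2 = t} :=
  measurable_snd (measurableSet_singleton t)

theorem prior_nonneg (ρ : Measure (X × Bool)) (t : Bool) : 0 ≤ prior ρ t := measureReal_nonneg

theorem prior_add_prior (ρ : Measure (X × Bool)) [IsProbabilityMeasure ρ] :
    prior ρ true + prior ρ false = 1 := by
  have h := probReal_compl_eq_one_sub (μ := ρ) (measurableSet_label_eq (X := X) true)
  rw [compl_label_eq, Bool.not_true] at h
  rw [prior, prior, h]
  ring

variable {ρ : Measure (X × Bool)} [IsProbabilityMeasure ρ]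

theorem isProbabilityMeasure_classLaw {t : Bool} (ht : prior ρ t ≠ 0) :
    IsProbabilityMeasure (classLaw ρ t) := by
  have h : ρ {p | p.2 = t} ≠ 0 := fun h => ht (by simp [prior, measureReal_def, h])
  have := cond_isProbabilityMeasure h
  exact Measure.isProbabilityMeasure_map measurable_fst.aemeasurable

theorem classLaw_eq_zero {t : Bool} (ht : prior ρ t = 0) : classLaw ρ t = 0 := by
  have h : ρ {p | p.2 = t} = 0 := by
    simpa [prior, measureReal_def, ENNReal.toReal_eq_zero_iff] using ht
  rw [classLaw, cond_eq_zero_of_meas_eq_zero h, Measure.map_zero]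

instance isFiniteMeasure_classLaw (t : Bool) : IsFiniteMeasure (classLaw ρ t) := by
  by_cases ht : prior ρ t = 0
  · rw [classLaw_eq_zero ht]; infer_instance
  · have := isProbabilityMeasure_classLaw ht; infer_instance

/-- Multiplying by the prior undoes the normalization of the conditional law and covers a null class
too, where `classLaw` is the zero measure. -/
theorem prior_mul_integral_classLaw (t : Bool) {F : X → ℝ} (hF : Measurable F) :
    prior ρ t * ∫ x, F x ∂(classLaw ρ t) = ∫ p in {p | p.2 = t}, F p.1 ∂ρ := by
  rw [classLaw, integral_map measurable_fst.aemeasurable hF.aestronglyMeasurable,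
    ProbabilityTheory.cond, integral_smul_measure, prior, measureReal_def, ENNReal.toReal_inv,
    smul_eq_mul]
  by_cases h : ρ {p | p.2 = t} = 0
  · rw [h, setIntegral_measure_zero _ h]; simp
  · rw [mul_inv_cancel_left₀ (ENNReal.toReal_ne_zero.2 ⟨h, measure_ne_top _ _⟩)]

theorem risk_eq_sum_classLaw {ℓ : ℝ → Bool → ℝ} {g : X → ℝ}
    (hm : ∀ y, Measurable fun x => ℓ (g x) y) {B : ℝ} (hB : ∀ y x, |ℓ (g x) y| ≤ B) :
    risk ρ ℓ g = prior ρ true * ∫ x, ℓ (g x) true ∂(classLaw ρ true) +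
      prior ρ false * ∫ x, ℓ (g x) false ∂(classLaw ρ false) := by
  have hme : Measurable fun p : X × Bool => ℓ (g p.1) p.2 :=
    measurable_from_prod_countable_left fun y => hm y
  rw [risk, ← integral_add_compl (measurableSet_label_eq true)
    (integrable_of_measurable_of_abs_le hme fun p => hB _ _), compl_label_eq,
    prior_mul_integral_classLaw _ (hm _), prior_mul_integral_classLaw _ (hm _)]
  congr 1 <;> refine setIntegral_congr_fun (measurableSet_label_eq _) fun p hp => ?_
  · simp only [Set.mem_ofPred_eq] at hp
    simp [hp]
  · simp only [Set.mem_ofPred_eq] at hp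
    simp [hp]

theorem measurable_inst (t : Bool) : Measurable (inst t : X × X → X) := by
  cases t
  · exact measurable_snd
  · exact measurable_fst

theorem map_inst_true (Q : Measure (X × X)) : Q.map (inst true) = Q.fst := rfl

theorem map_inst_false (Q : Measure (X × X)) : Q.map (inst false) = Q.snd := rfl

theorem integral_ofReal_smul_add {α : Type*} [MeasurableSpace α] {μ ν : Measure α} {a b : ℝ}
    (ha : 0 ≤ a) (hb : 0 ≤ b) {F : α → ℝ} (hμ : Integrable F μ) (hν : Integrable F ν) :
    ∫ x, F x ∂(ENNReal.ofReal a • μ + ENNReal.ofReal b • ν) =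
      a * ∫ x, F x ∂μ + b * ∫ x, F x ∂ν := by
  rw [integral_add_measure (hμ.smul_measure ENNReal.ofReal_ne_top)
    (hν.smul_measure ENNReal.ofReal_ne_top), integral_smul_measure, integral_smul_measure,
    ENNReal.toReal_ofReal ha, ENNReal.toReal_ofReal hb, smul_eq_mul, smul_eq_mul]

theorem integral_pcompLaw (t : Bool) {F : X → ℝ} (hF : Measurable F) {B : ℝ}
    (hB : ∀ x, |F x| ≤ B) :
    ∫ x, F x ∂(pcompLaw ρ t) =
      (prior ρ t * ∫ x, F x ∂(classLaw ρ t) +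
        prior ρ (!t) ^ 2 * ∫ x, F x ∂(classLaw ρ (!t))) / (prior ρ (!t) ^ 2 + prior ρ t) := by
  have h0 := prior_nonneg ρ t
  rw [pcompLaw, integral_ofReal_smul_add (by positivity) (by positivity)
    (integrable_of_measurable_of_abs_le hF hB) (integrable_of_measurable_of_abs_le hF hB)]
  ring

theorem integral_comp_inst_prod (μ ν : Measure X) [IsFiniteMeasure μ] [IsFiniteMeasure ν]
    (t : Bool) (F : X → ℝ) :
    ∫ z, F (inst t z) ∂(μ.prod ν) =
      if t then ν.real Set.univ * ∫ x, F x ∂μ else μ.real Set.univ * ∫ x, F x ∂ν := by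
  cases t
  · simpa [inst] using integral_fun_snd (μ := μ) (ν := ν) F
  · simpa [inst] using integral_fun_fst (μ := μ) (ν := ν) F

theorem prior_mul_mass (t : Bool) : prior ρ t * (classLaw ρ t).real Set.univ = prior ρ t := by
  by_cases ht : prior ρ t = 0
  · simp [ht]
  · have := isProbabilityMeasure_classLaw ht
    simp

theorem sq_add_sq_pos_of_add_eq_one {a b : ℝ} (h : a + b = 1) : 0 < a ^ 2 + b ^ 2 := by
  nlinarith [sq_nonneg (a - b)]

theorem sq_add_pos_of_add_eq_one {a b : ℝ} (h : a + b = 1) : 0 < b ^ 2 + a := by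
  nlinarith [sq_nonneg (b - 1 / 2)]

theorem integral_map_inst (Q : Measure (X × X)) (t : Bool) {F : X → ℝ} (hF : Measurable F) :
    ∫ x, F x ∂(Q.map (inst t)) = ∫ z, F (inst t z) ∂Q :=
  integral_map (measurable_inst t).aemeasurable hF.aestronglyMeasurable

theorem integral_similarLaw_inst (t : Bool) {F : X → ℝ} (hF : Measurable F) {B : ℝ}
    (hB : ∀ x, |F x| ≤ B) :
    ∫ x, F x ∂((similarLaw ρ).map (inst t)) =
      (prior ρ true ^ 2 * ∫ x, F x ∂(classLaw ρ true) +
        prior ρ false ^ 2 * ∫ x, F x ∂(classLaw ρ false)) /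
          (prior ρ true ^ 2 + prior ρ false ^ 2) := by
  have hFi : Measurable fun z : X × X => F (inst t z) := hF.comp (measurable_inst t)
  rw [integral_map_inst _ _ hF, similarLaw, integral_ofReal_smul_add (by positivity)
    (by positivity) (integrable_of_measurable_of_abs_le hFi fun z => hB _)
    (integrable_of_measurable_of_abs_le hFi fun z => hB _), integral_comp_inst_prod,
    integral_comp_inst_prod]
  have h1 := prior_mul_mass (ρ := ρ) true
  have h2 := prior_mul_mass (ρ := ρ) false
  simp only [ite_self]
  rw [add_div]
  congr 1
  · linear_combination (prior ρ true / (prior ρ true ^ 2 + prior ρ false ^ 2) *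
      ∫ x, F x ∂(classLaw ρ true)) * h1
  · linear_combination (prior ρ false / (prior ρ true ^ 2 + prior ρ false ^ 2) *
      ∫ x, F x ∂(classLaw ρ false)) * h2

/-- Both products in `dissimilarLaw` contain both class laws, so a null class would make it the zero
measure. -/
theorem prior_ne_zero_of_dissimilarLaw [IsProbabilityMeasure (dissimilarLaw ρ)] (t : Bool) :
    prior ρ t ≠ 0 := by
  intro h
  have hz := classLaw_eq_zero h
  have : dissimilarLaw ρ = 0 := by
    cases t <;> simp [dissimilarLaw, hz]
  exact IsProbabilityMeasure.ne_zero _ this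

theorem integral_dissimilarLaw_inst [IsProbabilityMeasure (dissimilarLaw ρ)] (t : Bool)
    {F : X → ℝ} (hF : Measurable F) {B : ℝ} (hB : ∀ x, |F x| ≤ B) :
    ∫ x, F x ∂((dissimilarLaw ρ).map (inst t)) =
      (∫ x, F x ∂(classLaw ρ true) + ∫ x, F x ∂(classLaw ρ false)) / 2 := by
  have hFi : Measurable fun z : X × X => F (inst t z) := hF.comp (measurable_inst t)
  have := isProbabilityMeasure_classLaw (prior_ne_zero_of_dissimilarLaw (ρ := ρ) true)
  have := isProbabilityMeasure_classLaw (prior_ne_zero_of_dissimilarLaw (ρ := ρ) false)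
  rw [integral_map_inst _ _ hF, dissimilarLaw, integral_ofReal_smul_add (by positivity)
    (by positivity) (integrable_of_measurable_of_abs_le hFi fun z => hB _)
    (integrable_of_measurable_of_abs_le hFi fun z => hB _), integral_comp_inst_prod,
    integral_comp_inst_prod]
  cases t <;> simp <;> ring

/-- Under p_S both marginals are the same mixture, with weights proportional to π₊² and π₋². Under
comparison sampling the class + coefficient is π₊²(π₊ + π₋²), where the second factor is the common
denominator; class − is symmetric. -/
theorem sum_sq_prior_mul_integral {QS : Measure (X × X)}
    (hQS : HasPcompMarginals ρ QS ∨ QS = similarLaw ρ) {F : X → ℝ} (hF : Measurable F) {B : ℝ}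
    (hB : ∀ x, |F x| ≤ B) :
    prior ρ true ^ 2 * ∫ x, F x ∂(QS.map (inst true)) +
      prior ρ false ^ 2 * ∫ x, F x ∂(QS.map (inst false)) =
      prior ρ true ^ 2 * ∫ x, F x ∂(classLaw ρ true) +
        prior ρ false ^ 2 * ∫ x, F x ∂(classLaw ρ false) := by
  have hsum := prior_add_prior ρ
  rcases hQS with ⟨h1, h2⟩ | rfl
  · rw [map_inst_true, map_inst_false, h1, h2, integral_pcompLaw _ hF hB,
      integral_pcompLaw _ hF hB, Bool.not_true, Bool.not_false]
    have d1 := sq_add_pos_of_add_eq_one hsum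
    -- Both denominators equal 1 − π₊π₋.
    have hd : prior ρ true ^ 2 + prior ρ false = prior ρ false ^ 2 + prior ρ true := by
      linear_combination (prior ρ true - prior ρ false) * hsum
    rw [hd]
    field_simp
    rw [eq_sub_of_add_eq hsum]
    ring
  · rw [integral_similarLaw_inst _ hF hB, integral_similarLaw_inst _ hF hB]
    have := sq_add_sq_pos_of_add_eq_one hsum
    field_simp

/-- Under p_D both marginals are (p₊ + p₋)/2 and the weights add up to π₊² + π₋² − 1 = −2π₊π₋. Under
comparison sampling the cubic terms cancel, leaving −π₊π₋(1 − π₊π₋) over the common denominator 1 −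
π₊π₋. -/
theorem sum_sq_prior_sub_mul_integral {QD : Measure (X × X)} [IsProbabilityMeasure QD]
    (hQD : HasPcompMarginals ρ QD ∨ QD = dissimilarLaw ρ) {F : X → ℝ} (hF : Measurable F) {B : ℝ}
    (hB : ∀ x, |F x| ≤ B) :
    (prior ρ true ^ 2 - prior ρ false) * ∫ x, F x ∂(QD.map (inst true)) +
      (prior ρ false ^ 2 - prior ρ true) * ∫ x, F x ∂(QD.map (inst false)) =
      -(prior ρ true * prior ρ false) *
        (∫ x, F x ∂(classLaw ρ true) + ∫ x, F x ∂(classLaw ρ false)) := by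
  have hsum := prior_add_prior ρ
  rcases hQD with ⟨h1, h2⟩ | rfl
  · rw [map_inst_true, map_inst_false, h1, h2, integral_pcompLaw _ hF hB,
      integral_pcompLaw _ hF hB, Bool.not_true, Bool.not_false]
    have d1 := sq_add_pos_of_add_eq_one hsum
    have hd : prior ρ true ^ 2 + prior ρ false = prior ρ false ^ 2 + prior ρ true := by
      linear_combination (prior ρ true - prior ρ false) * hsum
    rw [hd]
    field_simp
    rw [eq_sub_of_add_eq hsum]
    ring
  · rw [integral_dissimilarLaw_inst _ hF hB, integral_dissimilarLaw_inst _ hF hB]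
    rw [eq_sub_of_add_eq hsum]
    ring

theorem integral_weightedLoss {ℓ : ℝ → Bool → ℝ} {g : X → ℝ}
    (hm : ∀ y, Measurable fun x => ℓ (g x) y) {B : ℝ} (hB : ∀ y x, |ℓ (g x) y| ≤ B)
    (μ : Measure X) [IsFiniteMeasure μ] (κ p q : ℝ) :
    ∫ x, weightedLoss ℓ κ p q (g x) ∂μ =
      κ * (p * ∫ x, ℓ (g x) true ∂μ - q * ∫ x, ℓ (g x) false ∂μ) := by
  simp only [weightedLoss]
  rw [integral_const_mul, integral_sub
    ((integrable_of_measurable_of_abs_le (hm _) (hB _)).const_mul _)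
    ((integrable_of_measurable_of_abs_le (hm _) (hB _)).const_mul _), integral_const_mul,
    integral_const_mul]

/-- The empirical risk is unbiased: its error is a sum of centred deviations. -/
theorem risk_sub_empRisk (hπ : prior ρ true ≠ prior ρ false) {QS QD : Measure (X × X)}
    [IsProbabilityMeasure QS] [IsProbabilityMeasure QD]
    (hQS : HasPcompMarginals ρ QS ∨ QS = similarLaw ρ)
    (hQD : HasPcompMarginals ρ QD ∨ QD = dissimilarLaw ρ) {ℓ : ℝ → Bool → ℝ} {g : X → ℝ}
    (hm : ∀ y, Measurable fun x => ℓ (g x) y) {B : ℝ} (hB : ∀ y x, |ℓ (g x) y| ≤ B)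
    {nS nD : ℕ} (zS : Fin nS → X × X) (zD : Fin nD → X × X) :
    risk ρ ℓ g - empRisk (prior ρ) ℓ zS zD g =
      ∑ t : Bool, deviation (QS.map (inst t)) (fun x => weightedLoss ℓ
          (prior ρ t ^ 2 / (prior ρ true - prior ρ false)) (prior ρ true) (prior ρ false) (g x))
          (fun i => inst t (zS i)) +
        ∑ t : Bool, deviation (QD.map (inst t)) (fun x => weightedLoss ℓ
          ((prior ρ t ^ 2 - prior ρ (!t)) / (prior ρ true - prior ρ false))
          (prior ρ false) (prior ρ true) (g x)) (fun i => inst t (zD i)) := by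
  have hΔ : prior ρ true - prior ρ false ≠ 0 := sub_ne_zero.2 hπ
  have hsum := prior_add_prior ρ
  have hS := fun y => sum_sq_prior_mul_integral hQS (hm y) (hB y)
  have hD := fun y => sum_sq_prior_sub_mul_integral hQD (hm y) (hB y)
  have hfin : ∀ (Q : Measure (X × X)) [IsProbabilityMeasure Q] (t : Bool),
      IsProbabilityMeasure (Q.map (inst t)) := fun Q _ t =>
    Measure.isProbabilityMeasure_map (measurable_inst t).aemeasurable
  simp only [empRisk, empRiskPart_weightS, empRiskPart_weightD, deviation, Fintype.sum_bool,
    Bool.not_true, Bool.not_false]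
  simp only [integral_weightedLoss hm hB]
  rw [risk_eq_sum_classLaw hm hB]
  -- The sample averages cancel; what remains, grouped by label, is the identity of expectations.
  suffices h : prior ρ true * ∫ x, ℓ (g x) true ∂(classLaw ρ true) +
      prior ρ false * ∫ x, ℓ (g x) false ∂(classLaw ρ false) =
      (prior ρ true * (prior ρ true ^ 2 * ∫ x, ℓ (g x) true ∂(QS.map (inst true)) +
        prior ρ false ^ 2 * ∫ x, ℓ (g x) true ∂(QS.map (inst false))) -
      prior ρ false * (prior ρ true ^ 2 * ∫ x, ℓ (g x) false ∂(QS.map (inst true)) +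
        prior ρ false ^ 2 * ∫ x, ℓ (g x) false ∂(QS.map (inst false))) +
      prior ρ false * ((prior ρ true ^ 2 - prior ρ false) *
          ∫ x, ℓ (g x) true ∂(QD.map (inst true)) +
        (prior ρ false ^ 2 - prior ρ true) * ∫ x, ℓ (g x) true ∂(QD.map (inst false))) -
      prior ρ true * ((prior ρ true ^ 2 - prior ρ false) *
          ∫ x, ℓ (g x) false ∂(QD.map (inst true)) +
        (prior ρ false ^ 2 - prior ρ true) * ∫ x, ℓ (g x) false ∂(QD.map (inst false)))) /
        (prior ρ true - prior ρ false) by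
    rw [h]
    ring
  -- For label +1 the class + coefficient is π₊³ − π₊π₋² = π₊(π₊ − π₋) and the class − coefficient
  -- is π₊π₋² − π₊π₋² = 0; label −1 is symmetric.
  rw [hS, hS, hD, hD, eq_div_iff hΔ]
  rw [eq_sub_of_add_eq hsum]
  ring

end Unbiasedness

/-! ### From deviations to the excess risk. -/

section ExcessRisk

/-- The two label weights are the class priors in some order; since they sum to 1, the Lipschitz
constant is just |κ|L. -/
theorem lipschitzWith_weightedLoss {ℓ : ℝ → Bool → ℝ} {L : ℝ≥0}
    (hℓ : ∀ y, LipschitzWith L fun z => ℓ z y) {p q : ℝ} (hp : 0 ≤ p) (hq : 0 ≤ q)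
    (hpq : p + q = 1) (κ : ℝ) : LipschitzWith (‖κ‖₊ * L) (weightedLoss ℓ κ p q) := by
  refine LipschitzWith.of_dist_le_mul fun z z' => ?_
  have h1 := (hℓ true).dist_le_mul z z'
  have h2 := (hℓ false).dist_le_mul z z'
  simp only [Real.dist_eq, NNReal.coe_mul, coe_nnnorm, Real.norm_eq_abs] at *
  have h : weightedLoss ℓ κ p q z - weightedLoss ℓ κ p q z' =
      κ * (p * (ℓ z true - ℓ z' true) - q * (ℓ z false - ℓ z' false)) := by
    simp only [weightedLoss]; ring
  rw [h, abs_mul, mul_assoc]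
  gcongr
  refine (abs_sub _ _).trans ?_
  rw [abs_mul, abs_mul, abs_of_nonneg hp, abs_of_nonneg hq]
  calc _ ≤ p * (L * |z - z'|) + q * (L * |z - z'|) := by gcongr
    _ = _ := by rw [← add_mul, hpq, one_mul]

theorem abs_weightedLoss_sub_le {ℓ : ℝ → Bool → ℝ} (hℓ0 : ∀ z y, 0 ≤ ℓ z y) {Cg Cℓ : ℝ}
    (hℓbdd : ∀ z y, |z| ≤ Cg → ℓ z y ≤ Cℓ) {p q : ℝ} (hp : 0 ≤ p) (hq : 0 ≤ q)
    (hpq : p + q = 1) (κ : ℝ) {z z' : ℝ} (hz : |z| ≤ Cg) (hz' : |z'| ≤ Cg) :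
    |weightedLoss ℓ κ p q z - weightedLoss ℓ κ p q z'| ≤ |κ| * Cℓ := by
  have h : weightedLoss ℓ κ p q z - weightedLoss ℓ κ p q z' =
      κ * (p * (ℓ z true - ℓ z' true) - q * (ℓ z false - ℓ z' false)) := by
    simp only [weightedLoss]; ring
  have hb : ∀ y, |ℓ z y - ℓ z' y| ≤ Cℓ := fun y => abs_le.2
    ⟨by linarith [hℓ0 z y, hℓbdd z' y hz'], by linarith [hℓ0 z' y, hℓbdd z y hz]⟩
  rw [h, abs_mul]
  gcongr
  refine (abs_sub _ _).trans ?_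
  rw [abs_mul, abs_mul, abs_of_nonneg hp, abs_of_nonneg hq]
  calc _ ≤ p * Cℓ + q * Cℓ := by gcongr <;> exact hb _
    _ = _ := by rw [← add_mul, hpq, one_mul]

/-- Putting both terms over √(2n) would turn the factor 2 into 2√2; it is rounded up to 4. -/
theorem deviation_bound_le {k L CG Cℓ s : ℝ} (hk : 0 ≤ k) (hL : 0 ≤ L) (hCG : 0 ≤ CG)
    (hs : 0 ≤ s) {n : ℕ} (hn : 0 < n) :
    2 * (k * L) * (CG / √(n : ℝ)) + 2 * (k * Cℓ) * √(s / (2 * n)) ≤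
      k * ((4 * L * CG + 2 * Cℓ * √s) / √(2 * n)) := by
  have hn' : (0 : ℝ) < n := by exact_mod_cast hn
  have h2n : √(2 * (n : ℝ)) ≤ 2 * √(n : ℝ) := by
    rw [Real.sqrt_le_left (by positivity), mul_pow, Real.sq_sqrt hn'.le]
    linarith
  have h1 : CG / √(n : ℝ) ≤ 2 * CG / √(2 * n) := by
    rw [div_le_div_iff₀ (Real.sqrt_pos.2 hn') (Real.sqrt_pos.2 (by positivity))]
    calc CG * √(2 * n) ≤ CG * (2 * √(n : ℝ)) := by gcongr
      _ = _ := by ring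
  rw [Real.sqrt_div hs]
  calc _ ≤ 2 * (k * L) * (2 * CG / √(2 * n)) + 2 * (k * Cℓ) * (√s / √(2 * n)) := by gcongr
    _ = _ := by ring

variable {X : Type*} [MeasurableSpace X]

/-- The bad event may be non-measurable; its measurable hull has the same measure, and the
complement of the hull is a good event. -/
theorem exists_measurableSet_of_measureReal_le {Ω : Type*} [MeasurableSpace Ω] {P : Measure Ω}
    [IsProbabilityMeasure P] {B : Set Ω} {δ : ℝ} (h : P.real B ≤ δ) :
    ∃ E : Set Ω, MeasurableSet E ∧ 1 - δ ≤ P.real E ∧ E ⊆ Bᶜ := by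
  refine ⟨(toMeasurable P B)ᶜ, (measurableSet_toMeasurable P B).compl, ?_,
    Set.compl_subset_compl.2 (subset_toMeasurable P B)⟩
  rw [probReal_compl_eq_one_sub (measurableSet_toMeasurable P B), measureReal_def,
    measure_toMeasurable, ← measureReal_def]
  linarith

theorem measureReal_exists_weightedLoss_deviation_gt_le {Ω : Type*} [MeasurableSpace Ω]
    {P : Measure Ω} [IsProbabilityMeasure P] {Q : Measure (X × X)} [IsProbabilityMeasure Q]
    {G : Set (X → ℝ)} (hGmeas : ∀ g ∈ G, Measurable g) (hGsep : PointwiseSeparable G)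
    {ℓ : ℝ → Bool → ℝ} (hℓ0 : ∀ z y, 0 ≤ ℓ z y) {Cg Cℓ CG : ℝ} {L : ℝ≥0}
    (hGbdd : ∀ g ∈ G, ∀ x, |g x| ≤ Cg) (hℓbdd : ∀ z y, |z| ≤ Cg → ℓ z y ≤ Cℓ)
    (hℓlip : ∀ y, LipschitzWith L fun z => ℓ z y) {gs : X → ℝ} (hgs : gs ∈ G)
    {p q : ℝ} (hp : 0 ≤ p) (hq : 0 ≤ q) (hpq : p + q = 1) (κ : ℝ) (t : Bool)
    {n : ℕ} (hn : 0 < n) (hRad : rademacherComplexity G n (Q.map (inst t)) ≤ CG / √(n : ℝ))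
    {δ : ℝ} (hδ : 0 < δ) (hδ1 : δ < 1) {Z : Fin n → Ω → X × X} (hZ : IsIIDSample P Q Z) :
    P.real {ω | ∃ g ∈ G, |κ| * ((4 * L * CG + 2 * Cℓ * √(Real.log (1 / δ))) / √(2 * n)) <
        deviation (Q.map (inst t)) (fun x => weightedLoss ℓ κ p q (g x))
            (fun i => inst t (Z i ω)) -
          deviation (Q.map (inst t)) (fun x => weightedLoss ℓ κ p q (gs x))
            (fun i => inst t (Z i ω))} ≤ δ := by
  have : IsProbabilityMeasure (Q.map (inst t)) :=
    Measure.isProbabilityMeasure_map (measurable_inst t).aemeasurable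
  have hlaw : ∀ i, HasLaw (fun ω => inst t (Z i ω)) (Q.map (inst t)) P := fun i => by
    refine ⟨(measurable_inst t).comp_aemeasurable (hZ.law i).aemeasurable, ?_⟩
    rw [← (hZ.law i).map_eq, AEMeasurable.map_map_of_aemeasurable
      (measurable_inst t).aemeasurable (hZ.law i).aemeasurable]
    rfl
  have hCG : 0 ≤ CG := by
    have h := (rademacherComplexity_nonneg ⟨gs, hgs⟩ hGbdd hn (Q.map (inst t))).trans hRad
    simpa using (le_div_iff₀ (Real.sqrt_pos.2 (by exact_mod_cast hn))).1 h
  have hlog : 0 ≤ Real.log (1 / δ) :=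
    Real.log_nonneg (by rw [le_div_iff₀ hδ]; linarith)
  have hmain := measureReal_exists_sample_deviation_gt_le (P := P) (Q.map (inst t)) hGmeas hGsep
    hGbdd (lipschitzWith_weightedLoss hℓlip hp hq hpq κ)
    (fun z z' => abs_weightedLoss_sub_le hℓ0 hℓbdd hp hq hpq κ) hn hgs hδ hδ1 hRad
    (hZ.indep.comp (fun _ => inst t) fun _ => measurable_inst t) hlaw
  refine (measureReal_mono ?_).trans hmain
  rintro ω ⟨g, hg, hlt⟩
  refine ⟨g, hg, lt_of_le_of_lt ?_ hlt⟩
  simpa using deviation_bound_le (abs_nonneg κ) L.coe_nonneg hCG hlog hn (Cℓ := Cℓ)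

variable {ρ : Measure (X × Bool)}

theorem ERMBoundWithProb.mono {ℓ : ℝ → Bool → ℝ} {G : Set (X → ℝ)} {QS QD : Measure (X × X)}
    {gs : X → ℝ} {nS nD : ℕ} {δ b b' : ℝ}
    (h : ERMBoundWithProb.{w} ρ ℓ G QS QD gs nS nD δ b) (hb : b ≤ b') :
    ERMBoundWithProb.{w} ρ ℓ G QS QD gs nS nD δ b' := by
  intro Ω _ P _ S D hS hD
  obtain ⟨E, hE, hPE, h⟩ := h Ω P S D hS hD
  exact ⟨E, hE, hPE, fun ω hω g hg => (h ω hω g hg).trans hb⟩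

theorem measureReal_union₄_le {Ω : Type*} [MeasurableSpace Ω] {P : Measure Ω}
    [IsFiniteMeasure P] {A B C D : Set Ω} {δ : ℝ} (hA : P.real A ≤ δ) (hB : P.real B ≤ δ)
    (hC : P.real C ≤ δ) (hD : P.real D ≤ δ) : P.real ((A ∪ B) ∪ (C ∪ D)) ≤ 4 * δ := by
  linarith [measureReal_union_le (μ := P) (A ∪ B) (C ∪ D), measureReal_union_le (μ := P) A B,
    measureReal_union_le (μ := P) C D]

/-- Off four bad events of probability at most δ/4 each, the four deviation differences between ĝ
and g* are bounded, and R̂(ĝ) ≤ R̂(g*) removes the empirical part. -/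
theorem ermBoundWithProb_of_rademacher [IsProbabilityMeasure ρ]
    (hπ : prior ρ true ≠ prior ρ false)
    {QS QD : Measure (X × X)} [IsProbabilityMeasure QS] [IsProbabilityMeasure QD]
    (hQS : HasPcompMarginals ρ QS ∨ QS = similarLaw ρ)
    (hQD : HasPcompMarginals ρ QD ∨ QD = dissimilarLaw ρ)
    {G : Set (X → ℝ)} (hGmeas : ∀ g ∈ G, Measurable g) (hGsep : PointwiseSeparable G)
    {ℓ : ℝ → Bool → ℝ} (hℓ0 : ∀ z y, 0 ≤ ℓ z y) {Cg Cℓ CG : ℝ} {L : ℝ≥0}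
    (hGbdd : ∀ g ∈ G, ∀ x, |g x| ≤ Cg) (hℓbdd : ∀ z y, |z| ≤ Cg → ℓ z y ≤ Cℓ)
    (hℓlip : ∀ y, LipschitzWith L fun z => ℓ z y)
    (hRadS : ∀ n : ℕ, 0 < n → ∀ t,
      rademacherComplexity G n (QS.map (inst t)) ≤ CG / √(n : ℝ))
    (hRadD : ∀ n : ℕ, 0 < n → ∀ t,
      rademacherComplexity G n (QD.map (inst t)) ≤ CG / √(n : ℝ))
    {gs : X → ℝ} (hgs : gs ∈ G) {δ : ℝ} (hδ : 0 < δ) {nS nD : ℕ} (hnS : 0 < nS)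
    (hnD : 0 < nD) :
    ERMBoundWithProb.{w} ρ ℓ G QS QD gs nS nD δ
      ((4 * L * CG + 2 * Cℓ * √(Real.log (4 / δ))) / |prior ρ true - prior ρ false| *
        ((prior ρ true ^ 2 + prior ρ false ^ 2) / √(2 * nS) +
          (|prior ρ true ^ 2 - prior ρ false| + |prior ρ true - prior ρ false ^ 2|) /
            √(2 * nD))) := by
  intro Ω _ P _ S D hS hD
  rcases le_or_gt 1 δ with hδ1 | hδ1
  · exact ⟨∅, MeasurableSet.empty, by simpa using hδ1, fun ω hω => absurd hω (by simp)⟩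
  have hsum := prior_add_prior ρ
  have hp := prior_nonneg ρ true
  have hq := prior_nonneg ρ false
  have hδ4 : (1 : ℝ) / (δ / 4) = 4 / δ := by field_simp
  have hbadS := fun t => measureReal_exists_weightedLoss_deviation_gt_le hGmeas hGsep hℓ0 hGbdd
    hℓbdd hℓlip hgs hp hq hsum (prior ρ t ^ 2 / (prior ρ true - prior ρ false)) t hnS
    (hRadS nS hnS t) (show 0 < δ / 4 by linarith) (by linarith) hS
  -- For dissimilar pairs the priors multiplying the two losses are exchanged.
  have hbadD := fun t => measureReal_exists_weightedLoss_deviation_gt_le hGmeas hGsep hℓ0 hGbdd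
    hℓbdd hℓlip hgs hq hp ((add_comm _ _).trans hsum)
    ((prior ρ t ^ 2 - prior ρ (!t)) / (prior ρ true - prior ρ false)) t hnD
    (hRadD nD hnD t) (show 0 < δ / 4 by linarith) (by linarith) hD
  have hunion := measureReal_union₄_le (hbadS true) (hbadS false) (hbadD true) (hbadD false)
  rw [mul_div_cancel₀ δ (by norm_num : (4 : ℝ) ≠ 0)] at hunion
  obtain ⟨E, hE, hPE, hEsub⟩ := exists_measurableSet_of_measureReal_le hunion
  refine ⟨E, hE, hPE, fun ω hω ghat hghat => ?_⟩
  have hω := hEsub hω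
  simp only [Set.mem_compl_iff, Set.mem_union, Set.mem_ofPred_eq, not_or, not_exists, not_and,
    not_lt, hδ4] at hω
  obtain ⟨⟨h1, h2⟩, h3, h4⟩ := hω
  have hm : ∀ g ∈ G, ∀ y, Measurable fun x => ℓ (g x) y := fun g hg y =>
    (hℓlip y).continuous.measurable.comp (hGmeas g hg)
  have hB : ∀ g ∈ G, ∀ y x, |ℓ (g x) y| ≤ Cℓ := fun g hg y x => by
    rw [abs_of_nonneg (hℓ0 _ _)]
    exact hℓbdd _ _ (hGbdd g hg x)
  have e1 := risk_sub_empRisk hπ hQS hQD (hm ghat hghat.1) (hB ghat hghat.1)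
    (fun i => S i ω) (fun i => D i ω)
  have e2 := risk_sub_empRisk hπ hQS hQD (hm gs hgs) (hB gs hgs)
    (fun i => S i ω) (fun i => D i ω)
  have hmin := hghat.2 gs hgs
  have i1 := h1 ghat hghat.1
  have i2 := h2 ghat hghat.1
  have i3 := h3 ghat hghat.1
  have i4 := h4 ghat hghat.1
  simp only [Fintype.sum_bool] at e1 e2
  rw [abs_div] at i1 i2 i3 i4
  rw [abs_of_nonneg (sq_nonneg (prior ρ true))] at i1
  rw [abs_of_nonneg (sq_nonneg (prior ρ false))] at i2
  rw [Bool.not_true] at i3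
  rw [Bool.not_false, abs_sub_comm] at i4
  simp only [Bool.not_true, Bool.not_false] at *
  set A := 4 * (L : ℝ) * CG + 2 * Cℓ * √(Real.log (4 / δ))
  have hrhs : A / |prior ρ true - prior ρ false| *
        ((prior ρ true ^ 2 + prior ρ false ^ 2) / √(2 * nS) +
          (|prior ρ true ^ 2 - prior ρ false| + |prior ρ true - prior ρ false ^ 2|) /
            √(2 * nD)) =
      prior ρ true ^ 2 / |prior ρ true - prior ρ false| * (A / √(2 * nS)) +
      prior ρ false ^ 2 / |prior ρ true - prior ρ false| * (A / √(2 * nS)) +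
      (|prior ρ true ^ 2 - prior ρ false| / |prior ρ true - prior ρ false| * (A / √(2 * nD)) +
      |prior ρ true - prior ρ false ^ 2| / |prior ρ true - prior ρ false| * (A / √(2 * nD))) := by
    ring
  rw [hrhs]
  linarith

/-- Extracts a constant independent of the sample sizes; |K| avoids having to know the sign of K. -/
theorem mul_add_div_sqrt_le {K a b : ℝ} (ha : 0 ≤ a) (hb : 0 ≤ b) {m n : ℕ} (hm : 0 < m)
    (hn : 0 < n) :
    K * (a / √(2 * m) + b / √(2 * n)) ≤
      |K| * (a + b) * (1 / √(m : ℝ) + 1 / √(n : ℝ)) := by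
  have hm' : (0 : ℝ) < m := by exact_mod_cast hm
  have hn' : (0 : ℝ) < n := by exact_mod_cast hn
  have h1 : a / √(2 * m) ≤ (a + b) / √(m : ℝ) := by gcongr <;> linarith
  have h2 : b / √(2 * n) ≤ (a + b) / √(n : ℝ) := by gcongr <;> linarith
  calc K * (a / √(2 * m) + b / √(2 * n)) ≤ |K| * (a / √(2 * m) + b / √(2 * n)) := by
        gcongr; exact le_abs_self K
    _ ≤ |K| * ((a + b) / √(m : ℝ) + (a + b) / √(n : ℝ)) := by gcongr
    _ = _ := by ring

theorem exists_nat_forall_mul_inv_sqrt_le (M : ℝ) {η : ℝ} (hη : 0 < η) :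
    ∃ N : ℕ, 0 < N ∧ ∀ m n : ℕ, N ≤ m → N ≤ n → M * (1 / √(m : ℝ) + 1 / √(n : ℝ)) ≤ η := by
  have hlim : Tendsto (fun n : ℕ => |M| * (1 / √(n : ℝ))) atTop (𝓝 0) := by
    have h : Tendsto (fun n : ℕ => √(n : ℝ)) atTop atTop :=
      Real.tendsto_sqrt_atTop.comp tendsto_natCast_atTop_atTop
    simpa using (h.inv_tendsto_atTop).const_mul |M|
  obtain ⟨N, hN⟩ := eventually_atTop.1 (hlim.eventually_le_const (half_pos hη))
  refine ⟨max N 1, by positivity, fun m n hm hn => ?_⟩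
  have h1 := hN m ((le_max_left _ _).trans hm)
  have h2 := hN n ((le_max_left _ _).trans hn)
  calc M * (1 / √(m : ℝ) + 1 / √(n : ℝ)) ≤ |M| * (1 / √(m : ℝ) + 1 / √(n : ℝ)) := by
        gcongr; exact le_abs_self M
    _ ≤ η := by rw [mul_add]; linarith

end ExcessRisk

end SDPcomp

theorem theorem3 {X : Type u} [MeasurableSpace X]
    (ρ : Measure (X × Bool)) [IsProbabilityMeasure ρ]
    (πp πm : ℝ) (hπp : πp = SDPcomp.prior ρ true) (hπm : πm = SDPcomp.prior ρ false)
    (hπ : πp ≠ πm)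
    (QS QD : Measure (X × X)) [IsProbabilityMeasure QS] [IsProbabilityMeasure QD]
    (hQS : SDPcomp.HasPcompMarginals ρ QS ∨ QS = SDPcomp.similarLaw ρ)
    (hQD : SDPcomp.HasPcompMarginals ρ QD ∨ QD = SDPcomp.dissimilarLaw ρ)
    (G : Set (X → ℝ)) (hGmeas : ∀ g ∈ G, Measurable g) (hGsep : SDPcomp.PointwiseSeparable G)
    (ℓ : ℝ → Bool → ℝ) (hℓ0 : ∀ z y, 0 ≤ ℓ z y)
    (Cg Cℓ CG : ℝ) (Lℓ : ℝ≥0)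
    (hGbdd : ∀ g ∈ G, ∀ x, |g x| ≤ Cg)
    (hℓbdd : ∀ z y, |z| ≤ Cg → ℓ z y ≤ Cℓ)
    (hℓlip : ∀ y, LipschitzWith Lℓ (fun z => ℓ z y))
    (hRad : ∀ n : ℕ, 0 < n → ∀ μ ∈ ({QS.fst, QS.snd, QD.fst, QD.snd} : Set (Measure X)),
      SDPcomp.rademacherComplexity G n μ ≤ CG / √(n : ℝ))
    (gstar : X → ℝ) (hgstar : SDPcomp.IsMinimizer G (SDPcomp.risk ρ ℓ) gstar) :
    (∀ δ : ℝ, 0 < δ → ∀ nS nD : ℕ, 0 < nS → 0 < nD →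
      SDPcomp.ERMBoundWithProb.{w, u} ρ ℓ G QS QD gstar nS nD δ
        ((4 * Lℓ * CG + 2 * Cℓ * √(Real.log (4 / δ))) / |πp - πm| *
          ((πp ^ 2 + πm ^ 2) / √(2 * nS) +
            (|πp ^ 2 - πm| + |πp - πm ^ 2|) / √(2 * nD)))) ∧
    (∀ ε : ℝ, 0 < ε → ∃ M : ℝ, ∀ nS nD : ℕ, 0 < nS → 0 < nD →
      SDPcomp.ERMBoundWithProb.{w, u} ρ ℓ G QS QD gstar nS nD ε
        (M * (1 / √(nS : ℝ) + 1 / √(nD : ℝ)))) ∧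
    (∀ ε : ℝ, 0 < ε → ∀ η : ℝ, 0 < η → ∃ N : ℕ, ∀ nS nD : ℕ, N ≤ nS → N ≤ nD →
      SDPcomp.ERMBoundWithProb.{w, u} ρ ℓ G QS QD gstar nS nD ε η) := by
  subst hπp hπm
  have hbound : ∀ δ : ℝ, 0 < δ → ∀ nS nD : ℕ, 0 < nS → 0 < nD →
      SDPcomp.ERMBoundWithProb.{w, u} ρ ℓ G QS QD gstar nS nD δ _ :=
    fun δ hδ nS nD hnS hnD => SDPcomp.ermBoundWithProb_of_rademacher hπ hQS hQD hGmeas hGsep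
      hℓ0 hGbdd hℓbdd hℓlip (fun n hn t => hRad n hn _ (by cases t <;> simp [
        SDPcomp.map_inst_true, SDPcomp.map_inst_false])) (fun n hn t => hRad n hn _ (by
        cases t <;> simp [SDPcomp.map_inst_true, SDPcomp.map_inst_false])) hgstar.1 hδ hnS hnD
  have hrate : ∀ ε : ℝ, 0 < ε → ∃ M : ℝ, ∀ nS nD : ℕ, 0 < nS → 0 < nD →
      SDPcomp.ERMBoundWithProb.{w, u} ρ ℓ G QS QD gstar nS nD ε
        -- The constant M is read off the bound at δ = ε, hence depends on ε only and not on the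
        -- sample sizes.
        (M * (1 / √(nS : ℝ) + 1 / √(nD : ℝ))) := fun ε hε => ⟨_, fun nS nD hnS hnD =>
    (hbound ε hε nS nD hnS hnD).mono
      (SDPcomp.mul_add_div_sqrt_le (by positivity) (by positivity) hnS hnD)⟩
  refine ⟨hbound, hrate, fun ε hε η hη => ?_⟩
  obtain ⟨M, hM⟩ := hrate ε hε
  obtain ⟨N, hN0, hN⟩ := SDPcomp.exists_nat_forall_mul_inv_sqrt_le M hη
  exact ⟨N, fun nS nD hnS hnD => (hM nS nD (hN0.trans_le hnS) (hN0.trans_le hnD)).mono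
    (hN nS nD hnS hnD)⟩
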